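/- Let $S^2$ be the standard two-sphere. A convex $C^\infty$ immersion $f:S^2\to E^3$ is a smooth immersion whose image is the boundary of a compact convex body in Euclidean space $E^3$; a point is umbilical if the second fundamental form there is a multiple of the first. A Hopf spheroid is a convex $C^\infty$ immersion $f:S^2\to E^3$ that has an umbilical point $p$ and a small closed disc $D\subset S^2$ around $p$ on which the mean curvature of $f$ is constant. The Carathéodory conjecture is true for Hopf spheroids: if $f$ is a Hopf spheroid, then (i) $f$ has at least two umbilical points; (ii) if $p$ is an isolated umbilical point of $f$ and the mean curvature of $f$ is constant on a closed disc around $p$, then the Euler–Poincaré index of the lines of curvature at $p$ (the total rotation, divided by $2\pi$, of a principal direction along a small circle run once counterclockwise around $p$) is well defined and is at most $1$. -/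

import Mathlib

open Set Filter Topology
open scoped Manifold ContDiff

noncomputable section

namespace HopfSpheroid

/-- Euclidean three-space. -/
abbrev E3 : Type := EuclideanSpace ℝ (Fin 3)

/-- The parameter plane. -/
abbrev E2 : Type := EuclideanSpace ℝ (Fin 2)

/-- The two-sphere, with Mathlib's smooth structure (stereographic charts). -/
abbrev S2 : Type := Metric.sphere (0 : E3) 1

/-! ### Fundamental forms of a parametrized surface `g : E2 → E3` -/

/-- First fundamental form of `g` at the parameter `u`. -/
def firstForm (g : E2 → E3) (u v w : E2) : ℝ :=
  inner ℝ (fderiv ℝ g u v) (fderiv ℝ g u w)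

/-- `n` is one of the two unit normal vectors of `g` at the parameter `u`. -/
def IsUnitNormal (g : E2 → E3) (u : E2) (n : E3) : Prop :=
  ‖n‖ = 1 ∧ ∀ v : E2, inner ℝ (fderiv ℝ g u v) n = 0

/-- Second fundamental form of `g` at the parameter `u`, with respect to the normal `n`. -/
def secondForm (g : E2 → E3) (n : E3) (u v w : E2) : ℝ :=
  inner ℝ (fderiv ℝ (fderiv ℝ g) u v w) n

/-- Mean curvature `(E N - 2 F M + G L) / (2 (E G - F ^ 2))` of `g` at the parameter `u`,
with respect to the normal `n`. -/
def meanCurvatureParam (g : E2 → E3) (n : E3) (u : E2) : ℝ :=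
  let e₁ : E2 := !₂[1, 0]
  let e₂ : E2 := !₂[0, 1]
  (firstForm g u e₁ e₁ * secondForm g n u e₂ e₂
      - 2 * firstForm g u e₁ e₂ * secondForm g n u e₁ e₂
      + firstForm g u e₂ e₂ * secondForm g n u e₁ e₁)
    / (2 * (firstForm g u e₁ e₁ * firstForm g u e₂ e₂ - firstForm g u e₁ e₂ ^ 2))

/-- The nonzero vector `v` is a principal direction of `g` at the parameter `u`: an eigenvector
of the second fundamental form with respect to the first. -/
def IsPrincipalDirection (g : E2 → E3) (u v : E2) : Prop :=
  v ≠ 0 ∧ ∃ n : E3, IsUnitNormal g u n ∧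
    ∃ k : ℝ, ∀ w : E2, secondForm g n u v w = k * firstForm g u v w

/-- `g` is umbilic at the parameter `u`: the second fundamental form is a multiple
of the first. -/
def IsUmbilicParam (g : E2 → E3) (u : E2) : Prop :=
  ∃ n : E3, IsUnitNormal g u n ∧
    ∃ k : ℝ, ∀ v w : E2, secondForm g n u v w = k * firstForm g u v w

/-! ### Immersed spheres -/

/-- The map `f` read in the chart of the sphere at `x`. -/
def localParam (f : S2 → E3) (x : S2) : E2 → E3 :=
  f ∘ (extChartAt (𝓡 2) x).symm

/-- The coordinates of `x` in the chart of the sphere at `x`. -/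
def center (x : S2) : E2 := extChartAt (𝓡 2) x x

/-- `f` is a smooth immersion of the sphere that bounds a compact convex body. -/
def IsConvexImmersion (f : S2 → E3) : Prop :=
  ContMDiff (𝓡 2) 𝓘(ℝ, E3) ∞ f ∧
  (∀ x : S2, Function.Injective (mfderiv (𝓡 2) 𝓘(ℝ, E3) f x)) ∧
  ∃ K : Set E3, IsCompact K ∧ Convex ℝ K ∧ (interior K).Nonempty ∧ range f = frontier K

/-- `ν` is a continuous unit normal field along `f`. -/
def IsGaussMap (f : S2 → E3) (ν : S2 → E3) : Prop :=
  Continuous ν ∧ ∀ x : S2, IsUnitNormal (localParam f x) (center x) (ν x)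

/-- The mean curvature function of `f` on the sphere, with respect to the unit normal
field `ν`. -/
def meanCurvature (f : S2 → E3) (ν : S2 → E3) (x : S2) : ℝ :=
  meanCurvatureParam (localParam f x) (ν x) (center x)

/-- `x` is an umbilical point of `f`. -/
def IsUmbilic (f : S2 → E3) (x : S2) : Prop :=
  IsUmbilicParam (localParam f x) (center x)

/-- `p` is an umbilical point of `f`, and the mean curvature of `f` is constant on some closed
disc around `p`. -/
def IsCMCUmbilic (f : S2 → E3) (p : S2) : Prop :=
  IsUmbilic f p ∧ ∃ ν : S2 → E3, IsGaussMap f ν ∧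
    ∃ r > (0 : ℝ), ∃ c : ℝ, ∀ x ∈ Metric.closedBall p r, meanCurvature f ν x = c

/-- A Hopf spheroid: a convex smooth immersion of the sphere, with an umbilical point around
which the mean curvature is constant. -/
def IsHopfSpheroid (f : S2 → E3) : Prop :=
  IsConvexImmersion f ∧ ∃ p : S2, IsCMCUmbilic f p

/-- `p` is an isolated umbilical point of `f`. -/
def IsIsolatedUmbilic (f : S2 → E3) (p : S2) : Prop :=
  IsUmbilic f p ∧ ∀ᶠ x in 𝓝[≠] p, ¬ IsUmbilic f x

/-- The unit vector of the parameter plane with polar angle `t`. -/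
def dir (t : ℝ) : E2 := !₂[Real.cos t, Real.sin t]

/-- The lines of curvature of `f` have index `j` at the isolated umbilical point `p`: along every
small circle around `p` (in the chart at `p`), run through once counterclockwise, a continuous
angle `θ` of a principal direction increases by `2 π j` in total. -/
def HasUmbilicIndex (f : S2 → E3) (p : S2) (j : ℝ) : Prop :=
  ∀ᶠ r in 𝓝[>] (0 : ℝ), ∃ θ : ℝ → ℝ, ContinuousOn θ (Icc 0 (2 * Real.pi)) ∧
    (∀ t ∈ Icc 0 (2 * Real.pi),
      IsPrincipalDirection (localParam f p) (center p + r • dir t) (dir (θ t))) ∧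
    θ (2 * Real.pi) - θ 0 = 2 * Real.pi * j

end HopfSpheroid

end

/-! In a positively oriented orthonormal frame of an immersion of the plane, write tangent vectors
as complex numbers. The shape operator then has the form `H Z + φ conj Z`, where `Z` is the complex
coframe, `H` the mean curvature up to sign and `φ` (`hopfCoeff`) the trace-free part. Umbilics are
the zeros of `φ`, and `v` is principal exactly when `φ conj (Z v)^2` is real. A principal direction
therefore turns half as fast as `φ`, and the index is `w / 2`, with `w` the winding number of `φ` on
small circles (`IsImmersion.principalAngle_increment`, `hasUmbilicIndex_iff`).

Where `H` is constant, the Codazzi equation says that `dφ + 2 i ω φ`, with `ω` the connection form,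
is a multiple of `conj Z`: up to lower-order terms `φ` is antiholomorphic. Hopf's argument would now
pass to isothermal coordinates. Here the equation is kept in polar form along ellipses that the
coframe at the umbilic maps to circles, as a perturbation of `r Ψ_r = i Ψ_t`. If `w` were positive,
a weighted circle average of `log ‖Ψ‖` would grow like a positive multiple of `-log r` as `r → 0`,
although `Ψ` is bounded. Hence `w ≤ 0` (`not_deriv_le_neg_div`, `flux_nonpos`, `winding_nonpos`,
`IsImmersion.winding_hopfCoeff_nonpos`). No finite order of vanishing is needed, and the index is in
fact at most `0`.

For a second umbilic, suppose that `p` is the only one. Then `φ` has no zero in the punctured chart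
at `p`, so its winding number is the same on small and on large circles. Large circles are small
circles around `-p` seen through an inversion, whose differential turns an almost constant principal
direction by `4π`; this forces `w = 4` (`winding_eq_four`), Poincaré–Hopf in this special case,
against `w ≤ 0`. -/

noncomputable section

namespace HopfSpheroid

open ComplexConjugate

/-! ### Change of parameter and passage between charts of the sphere. -/

section

/-- A smooth immersion of the whole parameter plane. -/
structure IsImmersion (g : E2 → E3) : Prop where
  smooth : ContDiff ℝ ∞ g
  inj : ∀ u, Function.Injective (fderiv ℝ g u)

lemma extChartAt_target_univ (p : S2) : (extChartAt (𝓡 2) p).target = univ := by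
  have : Fact (Module.finrank ℝ E3 = 2 + 1) := Fact.mk (@finrank_euclideanSpace_fin ℝ _ (2 + 1))
  simp only [extChartAt_target, modelWithCornersSelf_coe_symm, preimage_id, ModelWithCorners.range_eq_univ, inter_univ]
  exact stereographic'_target (-p)

/-- Inverse stereographic projection is a diffeomorphism of the whole plane onto the sphere minus a
point, so the chart expression is an immersion with no restriction of domain. -/
lemma IsImmersion.localParam {f : S2 → E3} (hf : ContMDiff (𝓡 2) 𝓘(ℝ, E3) ∞ f)
    (hi : ∀ x : S2, Function.Injective (mfderiv (𝓡 2) 𝓘(ℝ, E3) f x)) (p : S2) :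
    IsImmersion (localParam f p) := by
  have hs : ContMDiff 𝓘(ℝ, E2) (𝓡 2) ∞ (extChartAt (𝓡 2) p).symm := by
    rw [← contMDiffOn_univ, ← extChartAt_target_univ p]
    exact contMDiffOn_extChartAt_symm p
  have hg : ContMDiff 𝓘(ℝ, E2) 𝓘(ℝ, E3) ∞ (HopfSpheroid.localParam f p) := hf.comp hs
  refine ⟨hg.contDiff, fun u => ?_⟩
  rw [← mfderiv_eq_fderiv]
  have h1 : mfderiv 𝓘(ℝ, E2) 𝓘(ℝ, E3) (HopfSpheroid.localParam f p) u =
      (mfderiv (𝓡 2) 𝓘(ℝ, E3) f ((extChartAt (𝓡 2) p).symm u)).comp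
        (mfderiv 𝓘(ℝ, E2) (𝓡 2) (extChartAt (𝓡 2) p).symm u) :=
    mfderiv_comp u (hf.mdifferentiable (by simp) _) (hs.mdifferentiable (by simp) _)
  rw [h1]
  have h2 : (mfderiv 𝓘(ℝ, E2) (𝓡 2) (extChartAt (𝓡 2) p).symm u).IsInvertible := by
    have := isInvertible_mfderivWithin_extChartAt_symm (I := 𝓡 2) (x := p) (y := u)
      (by rw [extChartAt_target_univ]; trivial)
    simpa [mfderivWithin_univ] using this
  exact (hi _).comp h2.injective

section Pullback

variable {g h : E2 → E3} {σ : E2 → E2} {u : E2}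

lemma fderiv_pullback (hg : g =ᶠ[𝓝 u] h ∘ σ) (hh : ContDiff ℝ ∞ h) (hσ : ContDiffAt ℝ ∞ σ u) (v : E2) :
    fderiv ℝ g u v = fderiv ℝ h (σ u) (fderiv ℝ σ u v) := by
  rw [hg.fderiv_eq, fderiv_comp u (hh.differentiable (by simp) _) (hσ.differentiableAt (by simp))]
  rfl

lemma firstForm_pullback (hg : g =ᶠ[𝓝 u] h ∘ σ) (hh : ContDiff ℝ ∞ h) (hσ : ContDiffAt ℝ ∞ σ u)
    (v w : E2) :
    firstForm g u v w = firstForm h (σ u) (fderiv ℝ σ u v) (fderiv ℝ σ u w) := by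
  simp only [firstForm, fderiv_pullback hg hh hσ]

/-- The chain rule produces an extra term `Dh (D²σ)`; it is tangential, so pairing with the normal
removes it. -/
lemma secondForm_pullback (hg : g =ᶠ[𝓝 u] h ∘ σ) (hh : ContDiff ℝ ∞ h) (hσ : ContDiffAt ℝ ∞ σ u)
    {n : E3} (hn : IsUnitNormal h (σ u) n) (v w : E2) :
    secondForm g n u v w = secondForm h n (σ u) (fderiv ℝ σ u v) (fderiv ℝ σ u w) := by
  have hσd : DifferentiableAt ℝ σ u := hσ.differentiableAt (by simp)
  have hh' : DifferentiableAt ℝ (fderiv ℝ h) (σ u) :=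
    (hh.fderiv_right (m := ∞) (by simp)).differentiable (by simp) _
  have hσ' : DifferentiableAt ℝ (fderiv ℝ σ) u :=
    (hσ.fderiv_right (m := ∞) (by simp)).differentiableAt (by simp)
  have e1 : fderiv ℝ g =ᶠ[𝓝 u] fun x => (fderiv ℝ h (σ x)).comp (fderiv ℝ σ x) := by
    have hev : ∀ᶠ x in 𝓝 u, DifferentiableAt ℝ σ x := by
      have : ∀ᶠ x in 𝓝 u, ContDiffAt ℝ 1 σ x := (hσ.of_le (by simp)).eventually (by simp)
      exact this.mono fun x hx => hx.differentiableAt (by simp)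
    filter_upwards [hg.eventuallyEq_nhds, hev] with x hx hx2
    rw [hx.fderiv_eq, fderiv_comp x (hh.differentiable (by simp) _) hx2]
  have e2 : HasFDerivAt (fun x => fderiv ℝ h (σ x))
      ((fderiv ℝ (fderiv ℝ h) (σ u)).comp (fderiv ℝ σ u)) u :=
    hh'.hasFDerivAt.comp u hσd.hasFDerivAt
  have e3 := e2.clm_comp hσ'.hasFDerivAt
  rw [secondForm, e1.fderiv_eq, e3.fderiv]
  simp only [add_apply, ContinuousLinearMap.comp_apply,
    ContinuousLinearMap.compL_apply, ContinuousLinearMap.flip_apply, inner_add_left]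
  rw [secondForm, hn.2]
  simp

lemma fderiv_bijective_of_pullback (hg : g =ᶠ[𝓝 u] h ∘ σ) (hh : ContDiff ℝ ∞ h)
    (hσ : ContDiffAt ℝ ∞ σ u) (hi : Function.Injective (fderiv ℝ g u)) :
    Function.Bijective (fderiv ℝ σ u) := by
  have h1 : Function.Injective (fderiv ℝ σ u) := by
    intro v w hvw
    apply hi
    rw [fderiv_pullback hg hh hσ, fderiv_pullback hg hh hσ, hvw]
  exact ⟨h1, LinearMap.surjective_of_injective (f := (fderiv ℝ σ u : E2 →ₗ[ℝ] E2)) h1⟩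

lemma isUnitNormal_pullback (hg : g =ᶠ[𝓝 u] h ∘ σ) (hh : ContDiff ℝ ∞ h)
    (hσ : ContDiffAt ℝ ∞ σ u) (hi : Function.Injective (fderiv ℝ g u)) (n : E3) :
    IsUnitNormal g u n ↔ IsUnitNormal h (σ u) n := by
  have hb := fderiv_bijective_of_pullback hg hh hσ hi
  simp only [IsUnitNormal, fderiv_pullback hg hh hσ]
  exact and_congr_right fun _ => (hb.2.forall (p := fun v => inner ℝ (fderiv ℝ h (σ u) v) n = 0)).symm

lemma isUmbilicParam_pullback (hg : g =ᶠ[𝓝 u] h ∘ σ) (hh : ContDiff ℝ ∞ h)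
    (hσ : ContDiffAt ℝ ∞ σ u) (hi : Function.Injective (fderiv ℝ g u)) :
    IsUmbilicParam g u ↔ IsUmbilicParam h (σ u) := by
  have hb := fderiv_bijective_of_pullback hg hh hσ hi
  refine exists_congr fun n => ?_
  rw [isUnitNormal_pullback hg hh hσ hi]
  refine and_congr_right fun hn => exists_congr fun k => ?_
  simp only [secondForm_pullback hg hh hσ hn, firstForm_pullback hg hh hσ]
  rw [hb.2.forall (p := fun v => ∀ w, secondForm h n (σ u) v w = k * firstForm h (σ u) v w)]
  refine forall_congr' fun v => ?_
  rw [hb.2.forall (p := fun w => secondForm h n (σ u) (fderiv ℝ σ u v) w =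
    k * firstForm h (σ u) (fderiv ℝ σ u v) w)]

lemma e2_decomp (v : E2) : v = v 0 • (!₂[1, 0] : E2) + v 1 • (!₂[0, 1] : E2) := by
  ext i; fin_cases i <;> simp

lemma firstForm_add_smul (g : E2 → E3) (u x y : E2) (a b c d : ℝ) :
    firstForm g u (a • x + b • y) (c • x + d • y) =
      a * c * firstForm g u x x + (a * d + b * c) * firstForm g u x y
        + b * d * firstForm g u y y := by
  have : (inner ℝ (fderiv ℝ g u y) (fderiv ℝ g u x) : ℝ) = inner ℝ (fderiv ℝ g u x) (fderiv ℝ g u y) :=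
    real_inner_comm _ _
  simp only [firstForm, map_add, map_smul, inner_add_left, inner_add_right, inner_smul_left,
    inner_smul_right, this, RCLike.conj_to_real]
  ring

lemma secondForm_symm (hh : ContDiff ℝ ∞ h) (n : E3) (u v w : E2) :
    secondForm h n u v w = secondForm h n u w v := by
  have := (hh.contDiffAt (x := u)).isSymmSndFDerivAt (by simpa using ENat.LEInfty.out)
  rw [secondForm, secondForm, this.eq]

lemma secondForm_add_smul (hh : ContDiff ℝ ∞ h) (n : E3) (u x y : E2) (a b c d : ℝ) :
    secondForm h n u (a • x + b • y) (c • x + d • y) =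
      a * c * secondForm h n u x x + (a * d + b * c) * secondForm h n u x y
        + b * d * secondForm h n u y y := by
  have := secondForm_symm hh n u y x
  simp only [secondForm] at this
  simp only [secondForm, map_add, map_smul, inner_add_left, inner_smul_left, 
    add_apply, smul_apply, this, RCLike.conj_to_real]
  ring

/-- Numerator and denominator both acquire the square of the Jacobian determinant of `σ`. -/
lemma meanCurvatureParam_pullback (hg : g =ᶠ[𝓝 u] h ∘ σ) (hh : ContDiff ℝ ∞ h)
    (hσ : ContDiffAt ℝ ∞ σ u) (hi : Function.Injective (fderiv ℝ g u))
    {n : E3} (hn : IsUnitNormal h (σ u) n) :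
    meanCurvatureParam g n u = meanCurvatureParam h n (σ u) := by
  have hb := fderiv_bijective_of_pullback hg hh hσ hi
  have hdet : (fderiv ℝ σ u !₂[1, 0]) 0 * (fderiv ℝ σ u !₂[0, 1]) 1
      - (fderiv ℝ σ u !₂[1, 0]) 1 * (fderiv ℝ σ u !₂[0, 1]) 0 ≠ 0 := by
    intro h0
    set p := fderiv ℝ σ u !₂[1, 0] with hp
    set q := fderiv ℝ σ u !₂[0, 1] with hq
    have key : ∀ a b : ℝ, a • p + b • q = 0 → a = 0 ∧ b = 0 := by
      intro a b hab
      have : fderiv ℝ σ u !₂[a, b] = 0 := by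
        rw [e2_decomp !₂[a, b]]; simpa [← hp, ← hq] using hab
      have h3 := hb.1 (this.trans (map_zero _).symm)
      have h4 := congrArg (fun z : E2 => z 0) h3
      have h5 := congrArg (fun z : E2 => z 1) h3
      simp at h4 h5
      exact ⟨h4, h5⟩
    -- With zero determinant these cofactor combinations of the columns `p` and `q` vanish, so
    -- independence forces `p = 0`.
    have k1 := key (q 1) (-p 1) (by
      ext i; fin_cases i <;> simp <;> linarith)
    have k2 := key (q 0) (-p 0) (by
      ext i; fin_cases i <;> simp <;> linarith)
    have hp0 : p = 0 := by
      rw [e2_decomp p]; simp [neg_eq_zero.1 k1.2, neg_eq_zero.1 k2.2]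
    have := key 1 0 (by simp [hp0])
    simp at this
  have D1 := e2_decomp (fderiv ℝ σ u !₂[1, 0])
  have D2 := e2_decomp (fderiv ℝ σ u !₂[0, 1])
  simp only [meanCurvatureParam]
  simp only [firstForm_pullback hg hh hσ, secondForm_pullback hg hh hσ hn]
  generalize (fderiv ℝ σ u !₂[1, 0]) = p at *
  generalize (fderiv ℝ σ u !₂[0, 1]) = q at *
  rw [D1, D2]
  simp only [firstForm_add_smul, secondForm_add_smul hh]
  generalize p 0 = p0 at *
  generalize p 1 = p1 at *
  generalize q 0 = q0 at *
  generalize q 1 = q1 at *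
  generalize firstForm h (σ u) !₂[1, 0] !₂[1, 0] = E
  generalize firstForm h (σ u) !₂[1, 0] !₂[0, 1] = F
  generalize firstForm h (σ u) !₂[0, 1] !₂[0, 1] = G
  generalize secondForm h n (σ u) !₂[1, 0] !₂[1, 0] = L
  generalize secondForm h n (σ u) !₂[1, 0] !₂[0, 1] = M
  generalize secondForm h n (σ u) !₂[0, 1] !₂[0, 1] = N
  rw [← mul_div_mul_left (E * N - 2 * F * M + G * L) _ (pow_ne_zero 2 hdet)]
  congr 1 <;> ring

end Pullback

/-- Notions on the sphere are evaluated at the centre of a chart that varies with the point. The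
transition map lets all of them be read in the single chart at `p`. -/
lemma localParam_transition (f : S2 → E3) (p x : S2) {u : E2}
    (hu : (extChartAt (𝓡 2) p).symm u = x) :
    ∃ σ : E2 → E2, localParam f p =ᶠ[𝓝 u] localParam f x ∘ σ ∧ ContDiffAt ℝ ∞ σ u ∧
      σ u = center x := by
  refine ⟨extChartAt (𝓡 2) x ∘ (extChartAt (𝓡 2) p).symm, ?_, ?_, ?_⟩
  · have hc : ContinuousAt (extChartAt (𝓡 2) p).symm u :=
      continuousAt_extChartAt_symm'' (by rw [extChartAt_target_univ]; trivial)
    have : ∀ᶠ y in 𝓝 u, (extChartAt (𝓡 2) p).symm y ∈ (extChartAt (𝓡 2) x).source :=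
      hc.eventually (by rw [hu]; exact extChartAt_source_mem_nhds x)
    filter_upwards [this] with y hy
    simp only [localParam, Function.comp_apply, (extChartAt (𝓡 2) x).left_inv hy]
  · have h := contDiffWithinAt_ext_coord_change (I := 𝓡 2) (n := ∞) x p (y := u) ?_
    · rwa [ModelWithCorners.range_eq_univ, contDiffWithinAt_univ] at h
    · simp only [PartialEquiv.trans_source, PartialEquiv.symm_source, extChartAt_target_univ,
        univ_inter, mem_preimage, hu]
      exact mem_extChartAt_source x
  · simp only [Function.comp_apply, hu, center]

variable {f : S2 → E3}

lemma isUmbilic_iff (hf : ∀ x, IsImmersion (localParam f x)) (p : S2) (u : E2) :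
    IsUmbilic f ((extChartAt (𝓡 2) p).symm u) ↔ IsUmbilicParam (localParam f p) u := by
  obtain ⟨σ, h1, h2, h3⟩ := localParam_transition f p _ (u := u) rfl
  rw [isUmbilicParam_pullback h1 (hf _).smooth h2 ((hf p).inj u), h3]
  rfl

lemma isUnitNormal_gauss (hf : ∀ x, IsImmersion (localParam f x)) {ν : S2 → E3}
    (hν : IsGaussMap f ν) (p : S2) (u : E2) :
    IsUnitNormal (localParam f p) u (ν ((extChartAt (𝓡 2) p).symm u)) := by
  obtain ⟨σ, h1, h2, h3⟩ := localParam_transition f p _ (u := u) rfl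
  rw [isUnitNormal_pullback h1 (hf _).smooth h2 ((hf p).inj u), h3]
  exact hν.2 _

lemma meanCurvature_eq (hf : ∀ x, IsImmersion (localParam f x)) {ν : S2 → E3}
    (hν : IsGaussMap f ν) (p : S2) (u : E2) :
    meanCurvature f ν ((extChartAt (𝓡 2) p).symm u) =
      meanCurvatureParam (localParam f p) (ν ((extChartAt (𝓡 2) p).symm u)) u := by
  obtain ⟨σ, h1, h2, h3⟩ := localParam_transition f p _ (u := u) rfl
  rw [meanCurvatureParam_pullback h1 (hf _).smooth h2 ((hf p).inj u) (by rw [h3]; exact hν.2 _), h3]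
  rfl

lemma center_eq_zero (p : S2) : center p = 0 := by
  have : Fact (Module.finrank ℝ E3 = 2 + 1) := Fact.mk (@finrank_euclideanSpace_fin ℝ _ (2 + 1))
  change (stereographic' 2 (-p)) p = 0
  simp only [stereographic', OpenPartialHomeomorph.coe_trans, Function.comp_apply,
    stereographic_neg_apply]
  exact map_zero (OrthonormalBasis.fromOrthogonalSpanSingleton 2
    (ne_zero_of_mem_unit_sphere (-p))).repr

end

/-! ### Stereographic charts at antipodal points. -/

section

lemma extChartAt_symm_eq (p : S2) : ∃ B : E2 →ₗᵢ[ℝ] E3,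
    LinearMap.range B.toLinearMap = (Submodule.span ℝ {(p : E3)})ᗮ ∧
    ∀ x : E2, ((extChartAt (𝓡 2) p).symm x : E3) =
      (‖x‖ ^ 2 + 4)⁻¹ • ((4 : ℝ) • B x - (‖x‖ ^ 2 - 4) • (p : E3)) := by
  have : Fact (Module.finrank ℝ E3 = 2 + 1) := Fact.mk (@finrank_euclideanSpace_fin ℝ _ (2 + 1))
  -- The chart at `p` projects from `-p`, which is why the orthogonal complement of `-p` appears.
  let U : (Submodule.span ℝ {((-p : S2) : E3)})ᗮ ≃ₗᵢ[ℝ] E2 :=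
    (OrthonormalBasis.fromOrthogonalSpanSingleton 2 (ne_zero_of_mem_unit_sphere (-p))).repr
  let B : E2 →ₗᵢ[ℝ] E3 :=
    (Submodule.subtypeₗᵢ (Submodule.span ℝ {((-p : S2) : E3)})ᗮ).comp U.symm.toLinearIsometry
  have hB : ∀ x, B x = (U.symm x : E3) := fun x => rfl
  refine ⟨B, ?_, fun x => ?_⟩
  · have h1 : (Submodule.span ℝ {(p : E3)})ᗮ = (Submodule.span ℝ {((-p : S2) : E3)})ᗮ := by
      rw [coe_neg_sphere, ← Set.neg_singleton, Submodule.span_neg]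
    rw [h1]
    ext z
    constructor
    · rintro ⟨x, rfl⟩
      exact (U.symm x).2
    · intro hz
      exact ⟨U ⟨z, hz⟩, by
        change B _ = z
        rw [hB, U.symm_apply_apply]⟩
  · have h2 := stereographic'_symm_apply (n := 2) (-p) x
    have h3 : (extChartAt (𝓡 2) p).symm x = (stereographic' 2 (-p)).symm x := rfl
    have hn : ‖(U.symm x : E3)‖ = ‖x‖ := by
      rw [← hB]; exact B.norm_map x
    rw [h3, h2, hB]
    change (‖(U.symm x : E3)‖ ^ 2 + 4)⁻¹ • (4 : ℝ) • (U.symm x : E3) +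
        (‖(U.symm x : E3)‖ ^ 2 + 4)⁻¹ • (‖(U.symm x : E3)‖ ^ 2 - 4) • ((-p : S2) : E3) = _
    rw [hn]
    have h5 : ((-p : S2) : E3) = -(p : E3) := coe_neg_sphere p
    generalize (U.symm x : E3) = w
    rw [h5]
    module

/-- Projections from opposite poles differ by inversion in the circle of radius two. The isometry
`T` compares the two independently chosen orthonormal bases of the common plane orthogonal to `p`;
it may reverse orientation. -/
lemma extChartAt_symm_inversion (p : S2) : ∃ T : E2 ≃ₗᵢ[ℝ] E2, ∀ y : E2, y ≠ 0 →
    (extChartAt (𝓡 2) p).symm ((4 / ‖y‖ ^ 2) • y) = (extChartAt (𝓡 2) (-p)).symm (T y) := by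
  obtain ⟨B, hB, hBx⟩ := extChartAt_symm_eq p
  obtain ⟨C, hC, hCx⟩ := extChartAt_symm_eq (-p)
  have hr : LinearMap.range B.toLinearMap = LinearMap.range C.toLinearMap := by
    rw [hB, hC, coe_neg_sphere, ← Set.neg_singleton, Submodule.span_neg]
  let T : E2 ≃ₗᵢ[ℝ] E2 :=
    (B.equivRange.trans (LinearIsometryEquiv.ofEq _ _ hr)).trans C.equivRange.symm
  have hT : ∀ y, C (T y) = B y := by
    intro y
    have h1 : C.equivRange (T y) = LinearIsometryEquiv.ofEq _ _ hr (B.equivRange y) :=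
      C.equivRange.apply_symm_apply _
    exact congrArg Subtype.val h1
  refine ⟨T, fun y hy => ?_⟩
  have hy' : ‖y‖ ≠ 0 := norm_ne_zero_iff.2 hy
  apply Subtype.ext
  rw [hBx, hCx, hT, map_smul, norm_smul, T.norm_map, coe_neg_sphere, Real.norm_eq_abs,
    abs_of_nonneg (by positivity : (0:ℝ) ≤ 4 / ‖y‖ ^ 2)]
  generalize ‖y‖ = n at *
  have : n ^ 2 + 4 ≠ 0 := by positivity
  have : (4 / n ^ 2 * n) ^ 2 + 4 ≠ 0 := by positivity
  match_scalars <;> field_simp <;> ring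

lemma IsImmersion.comp_isometry {g : E2 → E3} (hg : IsImmersion g) (T : E2 ≃ₗᵢ[ℝ] E2) :
    IsImmersion (g ∘ T) := by
  refine ⟨hg.smooth.comp T.contDiff, fun u => ?_⟩
  have : fderiv ℝ (g ∘ T) u = (fderiv ℝ g (T u)).comp (T.toContinuousLinearEquiv : E2 →L[ℝ] E2) := by
    rw [fderiv_comp u (hg.smooth.differentiable (by simp) _) T.differentiableAt]
    congr 1
    exact T.toContinuousLinearEquiv.fderiv
  rw [this]
  exact (hg.inj _).comp T.injective

/-- Absorbing `T` into the parametrization around `-p` leaves a pure inversion as the transition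
map. -/
lemma exists_inverted_param {f : S2 → E3} (hf : ∀ x, IsImmersion (localParam f x)) (p : S2) :
    ∃ g : E2 → E3, IsImmersion g ∧ (∀ y ≠ 0, localParam f p ((4 / ‖y‖ ^ 2) • y) = g y) ∧
      (IsUmbilicParam g 0 → IsUmbilic f (-p)) := by
  obtain ⟨T, hT⟩ := extChartAt_symm_inversion p
  refine ⟨localParam f (-p) ∘ T, (hf _).comp_isometry T, fun y hy => ?_, fun h => ?_⟩
  · simp only [localParam, Function.comp_apply, hT y hy]
  · have := (isUmbilicParam_pullback (g := localParam f (-p) ∘ T) (h := localParam f (-p))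
      (σ := T) (u := 0) (EventuallyEq.refl _ _) (hf _).smooth T.contDiff.contDiffAt
      (((hf _).comp_isometry T).inj 0)).1 h
    rw [map_zero, ← center_eq_zero (-p)] at this
    exact this

end

section

/-! ### Adapted orthonormal frame of an immersion -/

/-- The cross product of Euclidean three-space. -/
def cross (x y : E3) : E3 :=
  !₂[x 1 * y 2 - x 2 * y 1, x 2 * y 0 - x 0 * y 2, x 0 * y 1 - x 1 * y 0]

lemma inner_cross_left (x y : E3) : inner ℝ x (cross x y) = 0 := by
  simp [cross, PiLp.inner_apply, Fin.sum_univ_three]; ring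

lemma inner_cross_right (x y : E3) : inner ℝ y (cross x y) = 0 := by
  simp [cross, PiLp.inner_apply, Fin.sum_univ_three]; ring

lemma inner_cross_self (x y : E3) :
    inner ℝ (cross x y) (cross x y) = inner ℝ x x * inner ℝ y y - inner ℝ x y ^ 2 := by
  simp only [cross, PiLp.inner_apply, Fin.sum_univ_three]
  simp
  ring

lemma contDiff_cross {F G : E2 → E3} (hF : ContDiff ℝ ∞ F) (hG : ContDiff ℝ ∞ G) :
    ContDiff ℝ ∞ fun u => cross (F u) (G u) := by
  have h1 := fun i => contDiff_euclidean.1 hF i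
  have h2 := fun i => contDiff_euclidean.1 hG i
  rw [contDiff_euclidean]
  intro i
  fin_cases i
  · exact ((h1 1).mul (h2 2)).sub ((h1 2).mul (h2 1))
  · exact ((h1 2).mul (h2 0)).sub ((h1 0).mul (h2 2))
  · exact ((h1 0).mul (h2 1)).sub ((h1 1).mul (h2 0))

/-- First coordinate vector of the parameter plane. -/
def ex : E2 := !₂[1, 0]

/-- Second coordinate vector of the parameter plane. -/
def ey : E2 := !₂[0, 1]

lemma inner_fderiv_of_inner_const {F G : E2 → E3} (hF : ContDiff ℝ ∞ F)
    (hG : ContDiff ℝ ∞ G) {k : ℝ} (h : ∀ u, inner ℝ (F u) (G u) = k) (u v : E2) :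
    (inner ℝ (F u) (fderiv ℝ G u v) : ℝ) = -inner ℝ (fderiv ℝ F u v) (G u) := by
  have h1 := fderiv_inner_apply ℝ (hF.differentiable (by simp) u) (hG.differentiable (by simp) u) v
  simp only [h] at h1
  simp at h1
  linarith

/-- First vector of the Gram–Schmidt frame of the tangent plane. -/
def frame₁ (g : E2 → E3) (u : E2) : E3 := ‖fderiv ℝ g u ex‖⁻¹ • fderiv ℝ g u ex

/-- The component of the second coordinate vector orthogonal to `frame₁`. -/
def perp (g : E2 → E3) (u : E2) : E3 :=
  fderiv ℝ g u ey - (inner ℝ (fderiv ℝ g u ey) (frame₁ g u) : ℝ) • frame₁ g u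

/-- Second vector of the Gram–Schmidt frame of the tangent plane. -/
def frame₂ (g : E2 → E3) (u : E2) : E3 := ‖perp g u‖⁻¹ • perp g u

/-- The unit normal determined by the orientation of the parameter plane. -/
def normal (g : E2 → E3) (u : E2) : E3 := cross (frame₁ g u) (frame₂ g u)

variable {g : E2 → E3}

lemma contDiff_fderiv_apply {G : E2 → E3} (hG : ContDiff ℝ ∞ G) (v : E2) :
    ContDiff ℝ ∞ fun u => fderiv ℝ G u v :=
  (hG.fderiv_right (m := ∞) (by simp)).clm_apply contDiff_const

namespace IsImmersion

lemma fderiv_ex_ne (hg : IsImmersion g) (u : E2) : fderiv ℝ g u ex ≠ 0 := by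
  intro h
  have := hg.inj u (h.trans (map_zero _).symm)
  have := congrArg (fun z : E2 => z 0) this
  simp [ex] at this

lemma perp_ne (hg : IsImmersion g) (u : E2) : perp g u ≠ 0 := by
  intro h
  have h1 : fderiv ℝ g u (ey - ((inner ℝ (fderiv ℝ g u ey) (frame₁ g u) : ℝ) * ‖fderiv ℝ g u ex‖⁻¹) • ex) = 0 := by
    rw [map_sub, map_smul, ← smul_smul]
    exact h
  have := hg.inj u (h1.trans (map_zero _).symm)
  have := congrArg (fun z : E2 => z 1) this
  simp [ex, ey] at this

lemma contDiff_frame₁ (hg : IsImmersion g) : ContDiff ℝ ∞ (frame₁ g) :=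
  (((contDiff_fderiv_apply hg.smooth ex).norm ℝ hg.fderiv_ex_ne).inv
    fun u => norm_ne_zero_iff.2 (hg.fderiv_ex_ne u)).smul (contDiff_fderiv_apply hg.smooth ex)

lemma contDiff_perp (hg : IsImmersion g) : ContDiff ℝ ∞ (perp g) :=
  (contDiff_fderiv_apply hg.smooth ey).sub
    (((contDiff_fderiv_apply hg.smooth ey).inner ℝ hg.contDiff_frame₁).smul hg.contDiff_frame₁)

lemma contDiff_frame₂ (hg : IsImmersion g) : ContDiff ℝ ∞ (frame₂ g) :=
  ((hg.contDiff_perp.norm ℝ hg.perp_ne).inv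
    fun u => norm_ne_zero_iff.2 (hg.perp_ne u)).smul hg.contDiff_perp

lemma contDiff_normal (hg : IsImmersion g) : ContDiff ℝ ∞ (normal g) :=
  contDiff_cross hg.contDiff_frame₁ hg.contDiff_frame₂

lemma inner_frame₁_self (hg : IsImmersion g) (u : E2) : inner ℝ (frame₁ g u) (frame₁ g u) = (1 : ℝ) := by
  have := norm_ne_zero_iff.2 (hg.fderiv_ex_ne u)
  rw [frame₁, inner_smul_left, inner_smul_right, real_inner_self_eq_norm_sq, RCLike.conj_to_real]
  field_simp

lemma inner_frame₂_self (hg : IsImmersion g) (u : E2) : inner ℝ (frame₂ g u) (frame₂ g u) = (1 : ℝ) := by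
  have := norm_ne_zero_iff.2 (hg.perp_ne u)
  rw [frame₂, inner_smul_left, inner_smul_right, real_inner_self_eq_norm_sq, RCLike.conj_to_real]
  field_simp

lemma norm_frame₁ (hg : IsImmersion g) (u : E2) : ‖frame₁ g u‖ = 1 := by
  rw [← sq_eq_sq₀ (norm_nonneg _) zero_le_one, ← real_inner_self_eq_norm_sq,
    hg.inner_frame₁_self, one_pow]

lemma norm_frame₂ (hg : IsImmersion g) (u : E2) : ‖frame₂ g u‖ = 1 := by
  rw [← sq_eq_sq₀ (norm_nonneg _) zero_le_one, ← real_inner_self_eq_norm_sq,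
    hg.inner_frame₂_self, one_pow]

lemma inner_frame₁_perp (hg : IsImmersion g) (u : E2) : inner ℝ (frame₁ g u) (perp g u) = (0 : ℝ) := by
  rw [perp, inner_sub_right, inner_smul_right, hg.inner_frame₁_self, real_inner_comm]
  ring

lemma inner_frame₁_frame₂ (hg : IsImmersion g) (u : E2) : inner ℝ (frame₁ g u) (frame₂ g u) = (0 : ℝ) := by
  rw [frame₂, inner_smul_right, hg.inner_frame₁_perp, mul_zero]

lemma inner_normal_self (hg : IsImmersion g) (u : E2) : inner ℝ (normal g u) (normal g u) = (1 : ℝ) := by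
  rw [normal, inner_cross_self, hg.inner_frame₁_self, hg.inner_frame₂_self, hg.inner_frame₁_frame₂]
  norm_num

lemma norm_normal (hg : IsImmersion g) (u : E2) : ‖normal g u‖ = 1 := by
  rw [← sq_eq_sq₀ (norm_nonneg _) zero_le_one, ← real_inner_self_eq_norm_sq,
    hg.inner_normal_self, one_pow]

lemma inner_frame₁_normal (u : E2) : inner ℝ (frame₁ g u) (normal g u) = (0 : ℝ) :=
  inner_cross_left _ _

lemma inner_frame₂_normal (u : E2) : inner ℝ (frame₂ g u) (normal g u) = (0 : ℝ) :=
  inner_cross_right _ _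

lemma orthonormal_frame (hg : IsImmersion g) (u : E2) :
    Orthonormal ℝ ![frame₁ g u, frame₂ g u, normal g u] := by
  have h12 := hg.inner_frame₁_frame₂ u
  have h13 := inner_frame₁_normal (g := g) u
  have h23 := inner_frame₂_normal (g := g) u
  rw [orthonormal_iff_ite]
  intro i j
  fin_cases i <;> fin_cases j <;>
    simp [hg.norm_frame₁, hg.norm_frame₂, hg.norm_normal, h12, h13, h23,
      real_inner_comm (frame₁ g u), real_inner_comm (frame₂ g u) (normal g u)]

/-- Parseval's identity in the adapted frame. -/
lemma inner_eq_frame (hg : IsImmersion g) (u : E2) (x y : E3) :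
    (inner ℝ x y : ℝ) = inner ℝ x (frame₁ g u) * inner ℝ y (frame₁ g u)
      + inner ℝ x (frame₂ g u) * inner ℝ y (frame₂ g u)
      + inner ℝ x (normal g u) * inner ℝ y (normal g u) := by
  have ho := hg.orthonormal_frame u
  let b := OrthonormalBasis.mk ho (by
    rw [ho.linearIndependent.span_eq_top_of_card_eq_finrank (by simp)])
  have := b.sum_inner_mul_inner x y
  rw [← this, Fin.sum_univ_three]
  simp only [b, OrthonormalBasis.coe_mk, Matrix.cons_val_zero, Matrix.cons_val_one, Matrix.cons_val]
  rw [real_inner_comm y, real_inner_comm y, real_inner_comm y]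

lemma fderiv_ex (hg : IsImmersion g) (u : E2) :
    fderiv ℝ g u ex = ‖fderiv ℝ g u ex‖ • frame₁ g u := by
  rw [frame₁, smul_smul, mul_inv_cancel₀ (norm_ne_zero_iff.2 (hg.fderiv_ex_ne u)), one_smul]

lemma fderiv_ey (hg : IsImmersion g) (u : E2) :
    fderiv ℝ g u ey = (inner ℝ (fderiv ℝ g u ey) (frame₁ g u) : ℝ) • frame₁ g u
      + ‖perp g u‖ • frame₂ g u := by
  rw [frame₂, smul_smul, mul_inv_cancel₀ (norm_ne_zero_iff.2 (hg.perp_ne u)), one_smul, perp]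
  abel

lemma inner_fderiv_normal (hg : IsImmersion g) (u v : E2) :
    inner ℝ (fderiv ℝ g u v) (normal g u) = (0 : ℝ) := by
  have hv : v = v 0 • ex + v 1 • ey := e2_decomp v
  rw [hv, map_add, map_smul, map_smul, hg.fderiv_ex, hg.fderiv_ey]
  simp [inner_add_left, inner_smul_left, inner_frame₁_normal, inner_frame₂_normal]

lemma isUnitNormal_normal (hg : IsImmersion g) (u : E2) : IsUnitNormal g u (normal g u) :=
  ⟨hg.norm_normal u, hg.inner_fderiv_normal u⟩

end IsImmersion

/-- The tangential part of `x`, as a complex number in the frame `frame₁`, `frame₂`. -/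
def tcoord (g : E2 → E3) (u : E2) (x : E3) : ℂ :=
  ⟨inner ℝ x (frame₁ g u), inner ℝ x (frame₂ g u)⟩

/-- The coframe. -/
def coframe (g : E2 → E3) (u v : E2) : ℂ := tcoord g u (fderiv ℝ g u v)

/-- The shape operator followed by the frame coordinates. -/
def shape (g : E2 → E3) (u v : E2) : ℂ := tcoord g u (-fderiv ℝ (normal g) u v)

/-- The connection form of the frame. -/
def conn (g : E2 → E3) (u v : E2) : ℝ := inner ℝ (fderiv ℝ (frame₁ g) u v) (frame₂ g u)

lemma tcoord_eq (u : E2) (x : E3) : tcoord g u x = (inner ℝ x (frame₁ g u) : ℝ)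
    + (inner ℝ x (frame₂ g u) : ℝ) * Complex.I := by
  apply Complex.ext <;> simp [tcoord]

lemma tcoord_add (u : E2) (x y : E3) : tcoord g u (x + y) = tcoord g u x + tcoord g u y := by
  apply Complex.ext <;> simp [tcoord, inner_add_left]

lemma tcoord_smul (u : E2) (a : ℝ) (x : E3) : tcoord g u (a • x) = a * tcoord g u x := by
  apply Complex.ext <;> simp [tcoord, inner_smul_left]

lemma coframe_apply (u v : E2) :
    coframe g u v = v 0 * coframe g u ex + v 1 * coframe g u ey := by
  have hv : v = v 0 • ex + v 1 • ey := e2_decomp v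
  conv_lhs => rw [hv]
  simp only [coframe, map_add, map_smul, tcoord_add, tcoord_smul]

lemma shape_apply (u v : E2) :
    shape g u v = v 0 * shape g u ex + v 1 * shape g u ey := by
  have hv : v = v 0 • ex + v 1 • ey := e2_decomp v
  conv_lhs => rw [hv]
  simp only [shape, map_add, map_smul, neg_add, ← smul_neg, tcoord_add, tcoord_smul]

lemma conn_apply (u v : E2) : conn g u v = v 0 * conn g u ex + v 1 * conn g u ey := by
  have hv : v = v 0 • ex + v 1 • ey := e2_decomp v
  conv_lhs => rw [hv]
  simp only [conn, map_add, map_smul, inner_add_left, inner_smul_left, RCLike.conj_to_real]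

namespace IsImmersion

lemma contDiff_tcoord (hg : IsImmersion g) {F : E2 → E3} (hF : ContDiff ℝ ∞ F) :
    ContDiff ℝ ∞ fun u => tcoord g u (F u) := by
  simp only [tcoord_eq]
  exact (Complex.ofRealCLM.contDiff.comp (hF.inner ℝ hg.contDiff_frame₁)).add
    ((Complex.ofRealCLM.contDiff.comp (hF.inner ℝ hg.contDiff_frame₂)).mul contDiff_const)

lemma contDiff_coframe (hg : IsImmersion g) (v : E2) : ContDiff ℝ ∞ fun u => coframe g u v :=
  hg.contDiff_tcoord (contDiff_fderiv_apply hg.smooth v)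

lemma contDiff_shape (hg : IsImmersion g) (v : E2) : ContDiff ℝ ∞ fun u => shape g u v :=
  hg.contDiff_tcoord (contDiff_fderiv_apply hg.contDiff_normal v).neg

lemma contDiff_conn (hg : IsImmersion g) (v : E2) : ContDiff ℝ ∞ fun u => conn g u v :=
  (contDiff_fderiv_apply hg.contDiff_frame₁ v).inner ℝ hg.contDiff_frame₂

lemma coframe_ex (hg : IsImmersion g) (u : E2) : coframe g u ex = ‖fderiv ℝ g u ex‖ := by
  rw [coframe, hg.fderiv_ex, tcoord_smul, norm_smul]
  have : tcoord g u (frame₁ g u) = 1 := by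
    apply Complex.ext <;> simp [tcoord, hg.norm_frame₁, hg.inner_frame₁_frame₂]
  simp [this, hg.norm_frame₁]

lemma coframe_ex_pos (hg : IsImmersion g) (u : E2) : 0 < (coframe g u ex).re := by
  rw [hg.coframe_ex]; simpa using hg.fderiv_ex_ne u

lemma coframe_ex_im (hg : IsImmersion g) (u : E2) : (coframe g u ex).im = 0 := by
  rw [hg.coframe_ex]; simp

lemma coframe_ey_im (hg : IsImmersion g) (u : E2) : 0 < (coframe g u ey).im := by
  have : (coframe g u ey).im = ‖perp g u‖ := by
    simp only [coframe, tcoord]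
    rw [hg.fderiv_ey]
    simp [inner_add_left, inner_smul_left, hg.inner_frame₁_frame₂, hg.norm_frame₂]
  rw [this]
  exact norm_pos_iff.2 (hg.perp_ne u)

lemma inner_normal_fderiv_normal (hg : IsImmersion g) (u v : E2) :
    inner ℝ (fderiv ℝ (normal g) u v) (normal g u) = (0 : ℝ) := by
  have hd := hg.contDiff_normal.differentiable (by simp) u
  have h1 := fderiv_inner_apply ℝ hd hd v
  simp only [hg.inner_normal_self] at h1
  rw [fderiv_fun_const, real_inner_comm] at h1
  simp at h1
  linarith

/-- Structure equation for the tangential part of an exact vector-valued one-form without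
normal component. -/
lemma fderiv_tcoord (hg : IsImmersion g) {G : E2 → E3} (hG : ContDiff ℝ ∞ G)
    (hn : ∀ u v, inner ℝ (fderiv ℝ G u v) (normal g u) = (0 : ℝ)) (u v w : E2) :
    fderiv ℝ (fun u => tcoord g u (fderiv ℝ G u w)) u v =
      tcoord g u (fderiv ℝ (fderiv ℝ G) u v w)
        - Complex.I * conn g u v * tcoord g u (fderiv ℝ G u w) := by
  have hGd : DifferentiableAt ℝ (fderiv ℝ G) u :=
    (hG.fderiv_right (m := ∞) (by simp)).differentiable (by simp) u
  have hGw : HasFDerivAt (fun u => fderiv ℝ G u w) ((fderiv ℝ (fderiv ℝ G) u).flip w) u := by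
    have := hGd.hasFDerivAt.clm_apply (hasFDerivAt_const w u)
    simpa using this
  have h1 := hg.contDiff_frame₁.differentiable (by simp) u
  have h2 := hg.contDiff_frame₂.differentiable (by simp) u
  have d1 := hGw.inner ℝ h1.hasFDerivAt
  have d2 := hGw.inner ℝ h2.hasFDerivAt
  have hd := (Complex.ofRealCLM.hasFDerivAt.comp u d1).add
    ((Complex.ofRealCLM.hasFDerivAt.comp u d2).mul_const Complex.I)
  have e : (fun u => tcoord g u (fderiv ℝ G u w)) =
      (Complex.ofRealCLM ∘ fun u => (inner ℝ (fderiv ℝ G u w) (frame₁ g u) : ℝ)) +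
      fun u => (Complex.ofRealCLM ∘ fun u => (inner ℝ (fderiv ℝ G u w) (frame₂ g u) : ℝ)) u * Complex.I := by
    funext u; simp [tcoord_eq]
  rw [e, hd.fderiv]
  -- Modulo the normal, the derivatives of the frame are `ω frame₂` and `-ω frame₁`. Their normal
  -- parts do not contribute, since `hn` makes the derivative of `G` tangential.
  have c1 : (inner ℝ (fderiv ℝ G u w) (fderiv ℝ (frame₁ g) u v) : ℝ) =
      inner ℝ (fderiv ℝ G u w) (frame₂ g u) * conn g u v := by
    rw [hg.inner_eq_frame u, hn, conn]
    have := inner_fderiv_of_inner_const hg.contDiff_frame₁ hg.contDiff_frame₁ hg.inner_frame₁_self u v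
    rw [real_inner_comm] at this
    have : (inner ℝ (fderiv ℝ (frame₁ g) u v) (frame₁ g u) : ℝ) = 0 := by linarith
    rw [this]; ring
  have c2 : (inner ℝ (fderiv ℝ G u w) (fderiv ℝ (frame₂ g) u v) : ℝ) =
      -(inner ℝ (fderiv ℝ G u w) (frame₁ g u) * conn g u v) := by
    rw [hg.inner_eq_frame u, hn, conn]
    have := inner_fderiv_of_inner_const hg.contDiff_frame₂ hg.contDiff_frame₂ hg.inner_frame₂_self u v
    rw [real_inner_comm] at this
    have h0 : (inner ℝ (fderiv ℝ (frame₂ g) u v) (frame₂ g u) : ℝ) = 0 := by linarith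
    have := inner_fderiv_of_inner_const hg.contDiff_frame₁ hg.contDiff_frame₂ hg.inner_frame₁_frame₂ u v
    rw [real_inner_comm] at this
    rw [h0, this]; ring
  apply Complex.ext
  · simp [tcoord, c1]; ring
  · simp [tcoord, c2]; ring

end IsImmersion

end

/-! ### The Hopf coefficient, umbilics, principal directions and the Codazzi equation. -/

section

variable {g : E2 → E3}

/-- The area form of the coframe, up to a constant factor. -/
def coarea (g : E2 → E3) (u : E2) : ℂ :=
  coframe g u ex * conj (coframe g u ey) - coframe g u ey * conj (coframe g u ex)

/-- The trace part of the shape operator in the frame: the mean curvature. -/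
def traceCoeff (g : E2 → E3) (u : E2) : ℂ :=
  (shape g u ex * conj (coframe g u ey) - shape g u ey * conj (coframe g u ex)) / coarea g u

/-- The trace-free part of the shape operator in the frame. -/
def hopfCoeff (g : E2 → E3) (u : E2) : ℂ :=
  (coframe g u ex * shape g u ey - coframe g u ey * shape g u ex) / coarea g u

namespace IsImmersion

lemma coarea_eq (hg : IsImmersion g) (u : E2) :
    coarea g u = -(2 * (coframe g u ex).re * (coframe g u ey).im : ℝ) * Complex.I := by
  have := hg.coframe_ex_im u
  apply Complex.ext <;> simp [coarea, this] <;> ring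

lemma coarea_ne (hg : IsImmersion g) (u : E2) : coarea g u ≠ 0 := by
  rw [hg.coarea_eq]
  have h1 := hg.coframe_ex_pos u
  have h2 := hg.coframe_ey_im u
  refine mul_ne_zero (neg_ne_zero.2 (Complex.ofReal_ne_zero.2 ?_)) Complex.I_ne_zero
  positivity

lemma contDiff_conj_comp {F : E2 → ℂ} (hF : ContDiff ℝ ∞ F) : ContDiff ℝ ∞ fun u => conj (F u) :=
  Complex.conjCLE.contDiff.comp hF

lemma contDiff_coarea (hg : IsImmersion g) : ContDiff ℝ ∞ (coarea g) :=
  ((hg.contDiff_coframe ex).mul (contDiff_conj_comp (hg.contDiff_coframe ey))).sub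
    ((hg.contDiff_coframe ey).mul (contDiff_conj_comp (hg.contDiff_coframe ex)))

lemma contDiff_hopfCoeff (hg : IsImmersion g) : ContDiff ℝ ∞ (hopfCoeff g) :=
  (((hg.contDiff_coframe ex).mul (hg.contDiff_shape ey)).sub
    ((hg.contDiff_coframe ey).mul (hg.contDiff_shape ex))).mul (hg.contDiff_coarea.inv hg.coarea_ne)

lemma contDiff_traceCoeff (hg : IsImmersion g) : ContDiff ℝ ∞ (traceCoeff g) :=
  (((hg.contDiff_shape ex).mul (contDiff_conj_comp (hg.contDiff_coframe ey))).sub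
    ((hg.contDiff_shape ey).mul (contDiff_conj_comp (hg.contDiff_coframe ex)))).mul
      (hg.contDiff_coarea.inv hg.coarea_ne)

/-- `Z` and `conj Z` form a complex basis of the real-linear maps from the plane to `ℂ`, because
`coarea` does not vanish. The two coefficients are given by Cramer's rule. -/
lemma shape_eq (hg : IsImmersion g) (u v : E2) :
    shape g u v = traceCoeff g u * coframe g u v + hopfCoeff g u * conj (coframe g u v) := by
  rw [shape_apply u v, coframe_apply u v, traceCoeff, hopfCoeff]
  have h := hg.coarea_ne u
  simp only [map_add, map_mul, Complex.conj_ofReal]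
  field_simp
  rw [coarea]
  ring

lemma coframe_ne_zero (hg : IsImmersion g) (u : E2) {v : E2} (hv : v ≠ 0) :
    coframe g u v ≠ 0 := by
  intro h
  rw [coframe_apply] at h
  have h1 := congrArg Complex.im h
  have h2 := congrArg Complex.re h
  simp [hg.coframe_ex_im, (hg.coframe_ey_im u).ne'] at h1
  simp [h1, (hg.coframe_ex_pos u).ne'] at h2
  apply hv
  ext i; fin_cases i
  · exact h2
  · exact h1

lemma firstForm_eq (hg : IsImmersion g) (u v w : E2) :
    firstForm g u v w = (coframe g u v * conj (coframe g u w)).re := by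
  rw [firstForm, hg.inner_eq_frame u, hg.inner_fderiv_normal]
  simp [coframe, tcoord]

/-- Weingarten's equation: differentiate the orthogonality of `dg w` and the normal. -/
lemma secondForm_normal (hg : IsImmersion g) (u v w : E2) :
    secondForm g (normal g u) u v w = (shape g u v * conj (coframe g u w)).re := by
  have hgd : DifferentiableAt ℝ (fderiv ℝ g) u :=
    (hg.smooth.fderiv_right (m := ∞) (by simp)).differentiable (by simp) u
  have hw : fderiv ℝ (fun u => fderiv ℝ g u w) u v = fderiv ℝ (fderiv ℝ g) u v w := by
    rw [fderiv_clm_apply hgd (differentiableAt_const w)]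
    simp
  have h1 := inner_fderiv_of_inner_const (contDiff_fderiv_apply hg.smooth w)
    hg.contDiff_normal (fun u => hg.inner_fderiv_normal u w) u v
  rw [hw] at h1
  have h2 : secondForm g (normal g u) u v w =
      inner ℝ (fderiv ℝ g u w) (-fderiv ℝ (normal g) u v) := by
    rw [inner_neg_right, h1, neg_neg, secondForm]
  rw [h2, hg.inner_eq_frame u, hg.inner_fderiv_normal]
  simp [coframe, shape, tcoord]
  ring

/-- Reality of the trace coefficient is equivalent to symmetry of the second fundamental form. -/
lemma traceCoeff_im (hg : IsImmersion g) (u : E2) : (traceCoeff g u).im = 0 := by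
  have h := secondForm_symm hg.smooth (normal g u) u ex ey
  rw [hg.secondForm_normal, hg.secondForm_normal] at h
  rw [traceCoeff, hg.coarea_eq]
  set d : ℝ := 2 * (coframe g u ex).re * (coframe g u ey).im with hd
  have h3 : shape g u ex * conj (coframe g u ey) - shape g u ey * conj (coframe g u ex)
      = ((shape g u ex * conj (coframe g u ey) - shape g u ey * conj (coframe g u ex)).im : ℝ) * Complex.I := by
    apply Complex.ext
    · simp at h ⊢; linarith
    · simp
  rw [h3, ← Complex.ofReal_neg, mul_div_mul_right _ _ Complex.I_ne_zero, ← Complex.ofReal_div, Complex.ofReal_im]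

lemma secondForm_eq (hg : IsImmersion g) (u v w : E2) :
    secondForm g (normal g u) u v w = (traceCoeff g u).re * firstForm g u v w
      + (hopfCoeff g u * conj (coframe g u v) * conj (coframe g u w)).re := by
  rw [hg.secondForm_normal, hg.shape_eq, hg.firstForm_eq]
  have := hg.traceCoeff_im u
  simp [this]
  ring

/-- A unit normal is the frame normal up to a sign, which stays undetermined here and is carried
along as an inner product. -/
lemma normal_eq (hg : IsImmersion g) {u : E2} {n : E3} (hn : IsUnitNormal g u n) :
    n = (inner ℝ n (normal g u) : ℝ) • normal g u ∧ (inner ℝ n (normal g u) : ℝ) ^ 2 = 1 := by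
  have h1 : (inner ℝ n (frame₁ g u) : ℝ) = 0 := by
    rw [frame₁, inner_smul_right, real_inner_comm, hn.2, mul_zero]
  have h2 : (inner ℝ n (frame₂ g u) : ℝ) = 0 := by
    rw [frame₂, inner_smul_right, perp, inner_sub_right, inner_smul_right, h1, real_inner_comm _ n, hn.2]
    simp
  constructor
  · refine ext_inner_right ℝ fun x => ?_
    rw [hg.inner_eq_frame u, h1, h2, inner_smul_left, real_inner_comm x]
    simp
  · have h3 := hg.inner_eq_frame u n n
    rw [h1, h2, real_inner_self_eq_norm_sq, hn.1] at h3
    linarith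

lemma secondForm_of_isUnitNormal (hg : IsImmersion g) {u : E2} {n : E3} (hn : IsUnitNormal g u n)
    (v w : E2) : secondForm g n u v w =
      (inner ℝ n (normal g u) : ℝ) * secondForm g (normal g u) u v w := by
  conv_lhs => rw [(hg.normal_eq hn).1]
  rw [secondForm, inner_smul_right, secondForm]

lemma meanCurvatureParam_eq (hg : IsImmersion g) {u : E2} {n : E3} (hn : IsUnitNormal g u n) :
    meanCurvatureParam g n u = (inner ℝ n (normal g u) : ℝ) * (traceCoeff g u).re := by
  have h1 := hg.coframe_ex_pos u
  have h2 := hg.coframe_ey_im u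
  have h3 := hg.coframe_ex_im u
  change (firstForm g u ex ex * secondForm g n u ey ey
      - 2 * firstForm g u ex ey * secondForm g n u ex ey
      + firstForm g u ey ey * secondForm g n u ex ex)
    / (2 * (firstForm g u ex ex * firstForm g u ey ey - firstForm g u ex ey ^ 2)) = _
  have hden : firstForm g u ex ex * firstForm g u ey ey - firstForm g u ex ey ^ 2 =
      ((coframe g u ex).re * (coframe g u ey).im) ^ 2 := by
    simp [hg.firstForm_eq, h3]; ring
  have hd : (2 * (firstForm g u ex ex * firstForm g u ey ey - firstForm g u ex ey ^ 2)) ≠ 0 := by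
    rw [hden]; positivity
  rw [div_eq_iff hd]
  simp only [hg.secondForm_of_isUnitNormal hn, hg.secondForm_eq, hg.firstForm_eq]
  simp [h3]
  ring

/-- `φ` carries the trace-free part of the second form. Testing proportionality on the three pairs
of coordinate vectors, where the coframe is triangular, kills first its imaginary and then its real
part. -/
lemma isUmbilicParam_iff (hg : IsImmersion g) (u : E2) :
    IsUmbilicParam g u ↔ hopfCoeff g u = 0 := by
  constructor
  · rintro ⟨n, hn, k, hk⟩
    have hs := (hg.normal_eq hn).2
    set s : ℝ := inner ℝ n (normal g u) with hsd
    have hk' : ∀ v w, s * ((traceCoeff g u).re * firstForm g u v w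
      + (hopfCoeff g u * conj (coframe g u v) * conj (coframe g u w)).re) = k * firstForm g u v w := by
      intro v w
      rw [← hg.secondForm_eq, ← hg.secondForm_of_isUnitNormal hn, hk]
    have hs0 : s ≠ 0 := by rintro h; rw [h] at hs; norm_num at hs
    have h1 := hg.coframe_ex_pos u
    have h2 := hg.coframe_ey_im u
    have h3 := hg.coframe_ex_im u
    have k11 := hk' ex ex
    have k12 := hk' ex ey
    have k22 := hk' ey ey
    simp only [hg.firstForm_eq] at k11 k12 k22
    simp only [h3, Complex.mul_re, Complex.mul_im, Complex.conj_re, Complex.conj_im, neg_zero, mul_zero, sub_zero,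
      zero_mul] at k11 k12 k22
    set a := (coframe g u ex).re
    set b := (coframe g u ey).re
    set d := (coframe g u ey).im
    set x := (hopfCoeff g u).re
    set y := (hopfCoeff g u).im
    set H := (traceCoeff g u).re
    have e1 : s * H + s * x = k := by
      have : (a * a) * (s * H + s * x - k) = 0 := by linarith
      rcases mul_eq_zero.1 this with h | h
      · nlinarith
      · linarith
    have e2 : y = 0 := by
      have : (s * (a * d)) * y = 0 := by
        rw [← e1] at k12; linarith
      rcases mul_eq_zero.1 this with h | h
      · exact absurd h (by positivity)
      · exact h
    have e3 : x = 0 := by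
      have : (2 * s * (d * d)) * x = 0 := by
        rw [← e1, e2] at k22; linarith
      rcases mul_eq_zero.1 this with h | h
      · exact absurd h (by positivity)
      · exact h
    exact Complex.ext e3 e2
  · intro h
    refine ⟨normal g u, hg.isUnitNormal_normal u, (traceCoeff g u).re, fun v w => ?_⟩
    rw [hg.secondForm_eq, h]
    simp

lemma eq_zero_of_forall_re (hg : IsImmersion g) (u : E2) {z : ℂ}
    (h : ∀ w, (z * conj (coframe g u w)).re = 0) : z = 0 := by
  have h1 := hg.coframe_ex_pos u
  have h2 := hg.coframe_ey_im u
  have h3 := hg.coframe_ex_im u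
  have hx := h ex
  have hy := h ey
  simp [h3, h1.ne'] at hx
  simp [hx, h2.ne'] at hy
  exact Complex.ext hx hy

/-- An eigenvector is one for which `φ conj Z` is a real multiple of `Z`; multiplying by `conj Z`
turns this into reality of `φ conj Z ^ 2`. -/
lemma isPrincipalDirection_iff (hg : IsImmersion g) (u : E2) {v : E2} (hv : v ≠ 0) :
    IsPrincipalDirection g u v ↔ (hopfCoeff g u * conj (coframe g u v) ^ 2).im = 0 := by
  have hz := hg.coframe_ne_zero u hv
  constructor
  · rintro ⟨-, n, hn, k, hk⟩
    have hs := (hg.normal_eq hn).2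
    set s : ℝ := inner ℝ n (normal g u) with hsd
    have hs0 : s ≠ 0 := by rintro h; rw [h] at hs; norm_num at hs
    have h0 : (s * (traceCoeff g u).re - k : ℝ) * coframe g u v
        + s * (hopfCoeff g u * conj (coframe g u v)) = 0 := by
      apply hg.eq_zero_of_forall_re u
      intro w
      have := hk w
      rw [hg.secondForm_of_isUnitNormal hn, hg.secondForm_eq, hg.firstForm_eq, ← hsd] at this
      simp at this ⊢
      linarith
    have h1 : (s : ℂ) * (hopfCoeff g u * conj (coframe g u v) ^ 2) =
        ((k - s * (traceCoeff g u).re) * Complex.normSq (coframe g u v) : ℝ) := by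
      have := Complex.mul_conj (coframe g u v)
      push_cast at h0 ⊢
      rw [← this]
      linear_combination conj (coframe g u v) * h0
    have h2 := congrArg Complex.im h1
    rw [Complex.ofReal_im, Complex.im_ofReal_mul] at h2
    exact (mul_eq_zero.1 h2).resolve_left hs0
  · intro h
    refine ⟨hv, normal g u, hg.isUnitNormal_normal u, (traceCoeff g u).re +
      (hopfCoeff g u * conj (coframe g u v) ^ 2).re / Complex.normSq (coframe g u v), fun w => ?_⟩
    have hN : Complex.normSq (coframe g u v) ≠ 0 := by simpa using hz
    rw [hg.secondForm_eq, hg.firstForm_eq, add_mul]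
    congr 1
    set m := (hopfCoeff g u * conj (coframe g u v) ^ 2).re with hm
    have h1 : hopfCoeff g u * conj (coframe g u v) ^ 2 = (m : ℂ) := Complex.ext hm.symm (by simpa using h)
    have h2 : hopfCoeff g u * conj (coframe g u v) =
        (m / Complex.normSq (coframe g u v) : ℝ) * coframe g u v := by
      push_cast
      rw [← Complex.mul_conj]
      have hc : conj (coframe g u v) ≠ 0 := by simpa using hz
      field_simp
      linear_combination h1
    rw [h2, mul_assoc, Complex.re_ofReal_mul]

/-- The coframe has vanishing torsion. -/
lemma fderiv_coframe_symm (hg : IsImmersion g) (u v w : E2) :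
    fderiv ℝ (fun u => coframe g u w) u v + Complex.I * conn g u v * coframe g u w =
      fderiv ℝ (fun u => coframe g u v) u w + Complex.I * conn g u w * coframe g u v := by
  simp only [coframe]
  rw [hg.fderiv_tcoord hg.smooth hg.inner_fderiv_normal,
    hg.fderiv_tcoord hg.smooth hg.inner_fderiv_normal]
  have := (hg.smooth.contDiffAt (x := u)).isSymmSndFDerivAt (by simpa using ENat.LEInfty.out)
  rw [this.eq]
  ring

/-- The Codazzi equation. -/
lemma fderiv_shape_symm (hg : IsImmersion g) (u v w : E2) :
    fderiv ℝ (fun u => shape g u w) u v + Complex.I * conn g u v * shape g u w =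
      fderiv ℝ (fun u => shape g u v) u w + Complex.I * conn g u w * shape g u v := by
  have hN : ContDiff ℝ ∞ (fun u => -normal g u) := hg.contDiff_normal.neg
  have hn : ∀ u v, inner ℝ (fderiv ℝ (fun u => -normal g u) u v) (normal g u) = (0 : ℝ) := by
    intro u v
    rw [fderiv_fun_neg, neg_apply, inner_neg_left, hg.inner_normal_fderiv_normal, neg_zero]
  have e : ∀ u v, shape g u v = tcoord g u (fderiv ℝ (fun u => -normal g u) u v) := by
    intro u v
    rw [shape, fderiv_fun_neg, neg_apply]
  simp only [e]
  rw [hg.fderiv_tcoord hN hn, hg.fderiv_tcoord hN hn]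
  have := (hN.contDiffAt (x := u)).isSymmSndFDerivAt (by simpa using ENat.LEInfty.out)
  rw [this.eq]
  ring

/-- The Codazzi equation for the trace-free part, on a surface of constant mean curvature. -/
lemma codazzi_of_traceCoeff_const (hg : IsImmersion g) {u : E2} {k : ℂ}
    (hk : traceCoeff g =ᶠ[𝓝 u] fun _ => k) (v w : E2) :
    conj (coframe g u w) * (fderiv ℝ (hopfCoeff g) u v + 2 * Complex.I * conn g u v * hopfCoeff g u) =
      conj (coframe g u v) * (fderiv ℝ (hopfCoeff g) u w + 2 * Complex.I * conn g u w * hopfCoeff g u) := by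
  have dφ := hg.contDiff_hopfCoeff.differentiable (by simp) u
  have dZ := fun v => (hg.contDiff_coframe v).differentiable (by simp) u
  have key : ∀ v w, fderiv ℝ (fun u => shape g u w) u v =
      k * fderiv ℝ (fun u => coframe g u w) u v + fderiv ℝ (hopfCoeff g) u v * conj (coframe g u w)
        + hopfCoeff g u * conj (fderiv ℝ (fun u => coframe g u w) u v) := by
    intro v w
    have e : (fun u => shape g u w) =ᶠ[𝓝 u]
        fun u => k * coframe g u w + hopfCoeff g u * conj (coframe g u w) := by
      filter_upwards [hk] with x hx
      rw [hg.shape_eq, hx]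
    have h1 := ((dZ w).hasFDerivAt.const_mul k).add
      (dφ.hasFDerivAt.mul (Complex.conjCLE.toContinuousLinearMap.hasFDerivAt.comp u (dZ w).hasFDerivAt))
    rw [e.fderiv_eq]
    have h2 := h1.fderiv
    refine (congrArg (fun L => L v) h2).trans ?_
    simp
    ring
  have h1 := hg.fderiv_shape_symm u v w
  have h2 := hg.fderiv_coframe_symm u v w
  have h3 := congrArg conj h2
  rw [key, key, hg.shape_eq, hg.shape_eq, hk.eq_of_nhds] at h1
  simp only [map_add, map_mul, Complex.conj_I, Complex.conj_ofReal] at h3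
  -- The part `k Z` cancels by the vanishing of torsion. The conjugate torsion equation has
  -- connection term `-iω`, which moves to the other side and adds to the `iω` of the shape
  -- equation; hence the factor `2`.
  linear_combination h1 - k * h2 - hopfCoeff g u * h3

end IsImmersion

lemma isPrincipalDirection_pullback {g h : E2 → E3} {σ : E2 → E2} {u : E2}
    (hg : g =ᶠ[𝓝 u] h ∘ σ) (hh : ContDiff ℝ ∞ h)
    (hσ : ContDiffAt ℝ ∞ σ u) (hi : Function.Injective (fderiv ℝ g u)) {v : E2}
    (hv : IsPrincipalDirection g u v) : IsPrincipalDirection h (σ u) (fderiv ℝ σ u v) := by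
  have hb := fderiv_bijective_of_pullback hg hh hσ hi
  obtain ⟨h0, n, hn, k, hk⟩ := hv
  have hn' := (isUnitNormal_pullback hg hh hσ hi n).1 hn
  refine ⟨fun h => h0 (hb.1 (h.trans (map_zero _).symm)), n, hn', k, ?_⟩
  rw [hb.2.forall (p := fun w => secondForm h n (σ u) (fderiv ℝ σ u v) w =
    k * firstForm h (σ u) (fderiv ℝ σ u v) w)]
  intro w
  rw [← secondForm_pullback hg hh hσ hn', ← firstForm_pullback hg hh hσ, hk]

end

section

/-! ### Winding numbers of loops in the punctured plane -/

/-- A continuous function with values in the discrete set `c ℤ` is constant on a connected set. This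
rigidity yields uniqueness and homotopy invariance of winding numbers, the rotation of principal
angles, and constancy of the sign of the mean curvature. -/
lemma eq_of_continuousOn_of_int_mul {X : Type*} [TopologicalSpace X] {S : Set X}
    (hS : IsPreconnected S) {F : X → ℝ} (hF : ContinuousOn F S) {c : ℝ} (hc : c ≠ 0)
    (hint : ∀ x ∈ S, ∃ n : ℤ, F x = c * n) {x y : X} (hx : x ∈ S) (hy : y ∈ S) : F x = F y := by
  have key : ∀ x ∈ S, ∀ y ∈ S, ¬ F x / c < F y / c := by
    intro x hx y hy hlt
    obtain ⟨n, hn⟩ := hint x hx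
    obtain ⟨m, hm⟩ := hint y hy
    have e1 : F x / c = n := by rw [hn]; field_simp
    have e2 : F y / c = m := by rw [hm]; field_simp
    rw [e1, e2] at hlt
    have hlt' : n + 1 ≤ m := by exact_mod_cast hlt
    have hlt'' : (n : ℝ) + 1 ≤ m := by exact_mod_cast hlt'
    -- Two distinct integer values would force the intermediate value `n + 1/2`.
    obtain ⟨z, hz, hz2⟩ := hS.intermediate_value hx hy (hF.div_const c)
      (show (n : ℝ) + 1 / 2 ∈ Icc (F x / c) (F y / c) by
        rw [e1, e2]; constructor <;> linarith)
    obtain ⟨l, hl⟩ := hint z hz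
    have e3 : F z / c = l := by rw [hl]; field_simp
    simp only [e3] at hz2
    have h1 : n < l := by
      have : (n : ℝ) < l := by linarith
      exact_mod_cast this
    have h2 : l < n + 1 := by
      have : (l : ℝ) < n + 1 := by linarith
      exact_mod_cast this
    omega
  have := le_antisymm (not_lt.1 (key y hy x hx)) (not_lt.1 (key x hx y hy))
  field_simp at this
  exact this

/-- The loop `F`, parametrized by `[0, 2π]`, winds `w` times around the origin. -/
def HasWinding (F : ℝ → ℂ) (w : ℤ) : Prop :=
  ∃ L : ℝ → ℂ, ContinuousOn L (Icc 0 (2 * Real.pi)) ∧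
    (∀ t ∈ Icc 0 (2 * Real.pi), Complex.exp (L t) = F t) ∧
    L (2 * Real.pi) - L 0 = w * (2 * Real.pi * Complex.I)

lemma zero_mem_period : (0 : ℝ) ∈ Icc 0 (2 * Real.pi) := ⟨le_rfl, by positivity⟩

lemma two_pi_mem_period : (2 * Real.pi) ∈ Icc 0 (2 * Real.pi) := ⟨by positivity, le_rfl⟩

lemma HasWinding.unique {F : ℝ → ℂ} {w w' : ℤ} (h : HasWinding F w) (h' : HasWinding F w') :
    w = w' := by
  obtain ⟨L, hL, hF, hw⟩ := h
  obtain ⟨M, hM, hG, hw'⟩ := h'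
  have key := eq_of_continuousOn_of_int_mul isPreconnected_Icc
    (F := fun t => (L t - M t).im) (Complex.continuous_im.comp_continuousOn (hL.sub hM))
    Real.two_pi_pos.ne' (fun t ht => ?_) zero_mem_period two_pi_mem_period
  · have h1 := congrArg Complex.im hw
    have h2 := congrArg Complex.im hw'
    simp at key h1 h2
    have h3 : (w : ℝ) * (2 * Real.pi) = w' * (2 * Real.pi) := by linarith
    exact_mod_cast mul_right_cancel₀ Real.two_pi_pos.ne' h3
  · obtain ⟨n, hn⟩ := Complex.exp_eq_exp_iff_exists_int.1 ((hF t ht).trans (hG t ht).symm)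
    refine ⟨n, ?_⟩
    simp [hn]
    ring

lemma exists_continuous_log {X : Type*} [NormedAddCommGroup X] [NormedSpace ℝ X] {U : Set X}
    (hU : IsOpen U) (hc : Convex ℝ U) (hne : U.Nonempty) {F : X → ℂ} (hF : ContinuousOn F U)
    (h0 : ∀ x ∈ U, F x ≠ 0) :
    ∃ L : X → ℂ, ContinuousOn L U ∧ ∀ x ∈ U, Complex.exp (L x) = F x := by
  have : IsSimplyConnected U := by
    have := hc.contractibleSpace hne
    exact (inferInstance : SimplyConnectedSpace U)
  obtain ⟨L, hL, hL2⟩ := Complex.exists_continuousOn_eqOn_exp_comp this hU hF (by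
    rintro ⟨x, hx, hx0⟩; exact h0 x hx hx0)
  exact ⟨L, hL, fun x hx => hL2 hx⟩

/-- The logarithm is lifted once over the whole simply connected plane of pairs `(s, t)`; its
increment over a period in `t` is a continuous function of `s` with values in `2πi ℤ`. -/
lemma HasWinding.of_homotopy {H : ℝ × ℝ → ℂ} (hH : Continuous H) (h0 : ∀ x, H x ≠ 0)
    (hper : ∀ s, H (s, 2 * Real.pi) = H (s, 0)) :
    ∃ w : ℤ, ∀ s, HasWinding (fun t => H (s, t)) w := by
  obtain ⟨L, hL, hexp⟩ := exists_continuous_log isOpen_univ convex_univ univ_nonempty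
    hH.continuousOn (fun x _ => h0 x)
  rw [← continuousOn_univ.symm.eq] at hL
  have hn : ∀ s, ∃ n : ℤ, L (s, 2 * Real.pi) = L (s, 0) + n * (2 * Real.pi * Complex.I) := fun s =>
    Complex.exp_eq_exp_iff_exists_int.1 (by rw [hexp _ trivial, hexp _ trivial, hper])
  choose n hn using hn
  have hconst : ∀ s, n s = n 0 := by
    intro s
    have hc1 : Continuous fun s : ℝ => L (s, 2 * Real.pi) := hL.comp (by fun_prop)
    have hc2 : Continuous fun s : ℝ => L (s, 0) := hL.comp (by fun_prop)
    have key := eq_of_continuousOn_of_int_mul isPreconnected_univ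
      (F := fun s => (L (s, 2 * Real.pi) - L (s, 0)).im)
      (Complex.continuous_im.comp (hc1.sub hc2)).continuousOn
      Real.two_pi_pos.ne' (fun t _ => ⟨n t, by simp [hn]; ring⟩) (mem_univ s) (mem_univ 0)
    simp only [hn] at key
    simpa [Real.pi_ne_zero] using key
  refine ⟨n 0, fun s => ⟨fun t => L (s, t), (hL.comp (by fun_prop)).continuousOn,
    fun t _ => hexp _ trivial, ?_⟩⟩
  simp only [← hconst s, hn]; ring

/-- The winding number as the integral of the logarithmic derivative. -/
lemma HasWinding.integral_eq {F F' : ℝ → ℂ} {w : ℤ} (h : HasWinding F w)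
    (hF : ∀ t, HasDerivAt F (F' t) t) (hF' : Continuous F') (h0 : ∀ t, F t ≠ 0) :
    ∫ t in (0 : ℝ)..(2 * Real.pi), F' t / F t = w * (2 * Real.pi * Complex.I) := by
  obtain ⟨L, hL, hexp, hw⟩ := h
  have hFc : Continuous F := continuous_iff_continuousAt.2 fun t => (hF t).continuousAt
  rw [← hw]
  refine intervalIntegral.integral_eq_sub_of_hasDerivAt_of_le (by positivity) hL (fun t ht => ?_)
    ((hF'.div hFc h0).intervalIntegrable _ _)
  have hLt : ContinuousAt L t := hL.continuousAt (Icc_mem_nhds ht.1 ht.2)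
  -- `L` is only known to be continuous. Near `t` it agrees with the principal logarithm of a
  -- quotient close to `1`, which makes it differentiable.
  have hlog : L =ᶠ[𝓝 t] fun s => L t + Complex.log (F s / F t) := by
    have hc : ContinuousAt (fun s => (L s - L t).im) t :=
      Complex.continuous_im.continuousAt.comp (hLt.sub continuousAt_const)
    have : ∀ᶠ s in 𝓝 t, |(L s - L t).im| < Real.pi := by
      refine hc.abs.eventually_lt continuousAt_const ?_
      simpa using Real.pi_pos
    filter_upwards [this, Icc_mem_nhds ht.1 ht.2] with s hs hs2
    rw [← hexp s hs2, ← hexp t ⟨ht.1.le, ht.2.le⟩, ← Complex.exp_sub,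
      Complex.log_exp (abs_lt.1 hs).1 (abs_lt.1 hs).2.le]
    ring
  have h1 : HasDerivAt (fun s => F s / F t) (F' t / F t) t := (hF t).div_const _
  have h2 : HasDerivAt (fun s => L t + Complex.log (F s / F t)) (F' t / F t) t := by
    have h3 := h1.clog_real (by rw [div_self (h0 t)]; exact Complex.one_mem_slitPlane)
    rw [div_self (h0 t), div_one] at h3
    exact h3.const_add _
  exact h2.congr_of_eventuallyEq hlog

/-! ### Angles under orientation-preserving triangular maps -/

/-- The image of the direction with angle `θ` under the upper triangular matrix
`!![a, b; 0, d]`. -/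
def tri (a b d θ : ℝ) : ℂ := ⟨a * Real.cos θ + b * Real.sin θ, d * Real.sin θ⟩

/-- The angle of `tri a b d θ`, normalized to differ from `θ` by less than `π`. -/
def triAngle (a b d θ : ℝ) : ℝ := θ + (tri a b d θ * Complex.exp (-(θ * Complex.I))).arg

variable {a b d : ℝ}

/-- The eigenvalues `a` and `d` are positive, so no direction is sent to zero or to its opposite,
and the turning angle lies strictly between `-π` and `π`. -/
lemma tri_mul_exp_mem_slitPlane (ha : 0 < a) (hd : 0 < d) (θ : ℝ) :
    tri a b d θ * Complex.exp (-(θ * Complex.I)) ∈ Complex.slitPlane := by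
  rw [Complex.mem_slitPlane_iff_not_le_zero]
  intro hle
  obtain ⟨hre, him⟩ := Complex.le_def.1 hle
  set z := tri a b d θ * Complex.exp (-(θ * Complex.I)) with hz
  have h1 : tri a b d θ = z * Complex.exp (θ * Complex.I) := by
    rw [hz, mul_assoc, ← Complex.exp_add]; simp
  have hzr : z = (z.re : ℂ) := Complex.ext rfl (by simpa using him)
  rw [hzr, Complex.exp_mul_I, ← Complex.ofReal_cos, ← Complex.ofReal_sin] at h1
  have i1 := congrArg Complex.im h1
  have r1 := congrArg Complex.re h1
  simp [tri, Complex.cos_ofReal_re, Complex.sin_ofReal_re] at i1 r1 hre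
  rcases i1 with h | h
  · linarith
  · have hc : Real.cos θ ≠ 0 := by
      intro hc
      have := Real.sin_sq_add_cos_sq θ
      simp [h, hc] at this
    rw [h, mul_zero, add_zero] at r1
    have := mul_right_cancel₀ hc r1
    linarith

lemma tri_ne_zero (ha : 0 < a) (hd : 0 < d) (θ : ℝ) : tri a b d θ ≠ 0 := by
  intro h
  have := tri_mul_exp_mem_slitPlane (b := b) ha hd θ
  simp [h] at this

lemma tri_eq_norm_mul_exp (a b d θ : ℝ) :
    tri a b d θ = ‖tri a b d θ‖ * Complex.exp (triAngle a b d θ * Complex.I) := by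
  have h := Complex.norm_mul_exp_arg_mul_I (tri a b d θ * Complex.exp (-(θ * Complex.I)))
  have hn : ‖tri a b d θ * Complex.exp (-(θ * Complex.I))‖ = ‖tri a b d θ‖ := by
    rw [norm_mul, show -((θ : ℂ) * Complex.I) = ((-θ : ℝ) : ℂ) * Complex.I by push_cast; ring,
      Complex.norm_exp_ofReal_mul_I, mul_one]
  rw [hn] at h
  rw [triAngle, Complex.ofReal_add, add_mul, Complex.exp_add, mul_left_comm, h, mul_left_comm,
    ← Complex.exp_add]
  simp

lemma triAngle_add_int_mul_pi (a b d θ : ℝ) (k : ℤ) :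
    triAngle a b d (θ + k * Real.pi) = triAngle a b d θ + k * Real.pi := by
  have h1 : tri a b d (θ + k * Real.pi) = (-1) ^ k * tri a b d θ := by
    have hr : ((-1 : ℂ) ^ k) = (((-1 : ℝ) ^ k : ℝ) : ℂ) := by push_cast; rfl
    rw [hr, tri, Real.cos_add_int_mul_pi, Real.sin_add_int_mul_pi]
    generalize (-1 : ℝ) ^ k = m
    apply Complex.ext
    · simp [tri]; ring
    · simp [tri]; ring
  have h2 : Complex.exp (-(((θ + k * Real.pi : ℝ) : ℂ) * Complex.I)) =
      (-1) ^ k * Complex.exp (-(θ * Complex.I)) := by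
    have h3 : -(((θ + k * Real.pi : ℝ) : ℂ) * Complex.I) =
        -(θ * Complex.I) + k * (-(Real.pi * Complex.I)) := by push_cast; ring
    rw [h3, Complex.exp_add, Complex.exp_int_mul, Complex.exp_neg (Real.pi * Complex.I), Complex.exp_pi_mul_I]
    norm_num
    ring
  have h4 : ((-1 : ℂ) ^ k) * (-1) ^ k = 1 := by
    rw [← mul_zpow]; norm_num
  rw [triAngle, h1, h2, triAngle,
    show (-1 : ℂ) ^ k * tri a b d θ * ((-1) ^ k * Complex.exp (-(θ * Complex.I))) =
      ((-1 : ℂ) ^ k * (-1) ^ k) * (tri a b d θ * Complex.exp (-(θ * Complex.I))) by ring, h4, one_mul]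
  ring

lemma tri_of_exp {c τ θ : ℝ} (ha : a ≠ 0) (hd : d ≠ 0)
    (h : tri a b d θ = c * Complex.exp (τ * Complex.I)) :
    c * tri a⁻¹ (-(b / (a * d))) d⁻¹ τ = Complex.exp (θ * Complex.I) := by
  rw [Complex.exp_mul_I, ← Complex.ofReal_cos, ← Complex.ofReal_sin] at h ⊢
  have h1 := congrArg Complex.re h
  have h2 := congrArg Complex.im h
  simp [tri, Complex.cos_ofReal_re, Complex.sin_ofReal_re] at h1 h2
  apply Complex.ext
  · simp [tri, Complex.cos_ofReal_re]
    field_simp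
    linear_combination (-d) * h1 + b * h2
  · simp [tri, Complex.sin_ofReal_re]
    field_simp
    linear_combination (-1) * h2

/-- The inverse matrix turns the image back by the opposite angle, which again lies in `(-π, π)`;
the normalizations therefore match exactly, not only modulo `2π`. -/
lemma triAngle_triAngle (ha : 0 < a) (hd : 0 < d) (θ : ℝ) :
    triAngle a⁻¹ (-(b / (a * d))) d⁻¹ (triAngle a b d θ) = θ := by
  have h1 := tri_of_exp ha.ne' hd.ne' (tri_eq_norm_mul_exp a b d θ)
  have hpos : 0 < ‖tri a b d θ‖ := norm_pos_iff.2 (tri_ne_zero ha hd θ)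
  set τ := triAngle a b d θ with hτ
  set r := ‖tri a b d θ‖
  have hδ : τ - θ = (tri a b d θ * Complex.exp (-(θ * Complex.I))).arg := by
    rw [hτ, triAngle]; ring
  have h2 : tri a⁻¹ (-(b / (a * d))) d⁻¹ τ * Complex.exp (-(τ * Complex.I)) =
      ((r⁻¹ : ℝ) : ℂ) * Complex.exp (((θ - τ : ℝ) : ℂ) * Complex.I) := by
    have hr : (r : ℂ) ≠ 0 := Complex.ofReal_ne_zero.2 hpos.ne'
    rw [show ((θ - τ : ℝ) : ℂ) * Complex.I = θ * Complex.I + -(τ * Complex.I) by push_cast; ring,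
      Complex.exp_add, ← h1]
    push_cast
    field_simp
  have hs := tri_mul_exp_mem_slitPlane (b := b) ha hd θ
  have h3 := Complex.mem_slitPlane_iff_arg.1 hs
  have h4 := Complex.neg_pi_lt_arg (tri a b d θ * Complex.exp (-(θ * Complex.I)))
  have h5 := Complex.arg_le_pi (tri a b d θ * Complex.exp (-(θ * Complex.I)))
  have h6 := lt_of_le_of_ne h5 h3.1
  rw [← hδ] at h4 h6
  rw [triAngle, h2, Complex.arg_real_mul _ (inv_pos.2 hpos), Complex.arg_exp_mul_I,
    (toIocMod_eq_self Real.two_pi_pos).2 (by constructor <;> linarith)]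
  ring

lemma triAngle_triAngle_inv (ha : 0 < a) (hd : 0 < d) (θ : ℝ) :
    triAngle a b d (triAngle a⁻¹ (-(b / (a * d))) d⁻¹ θ) = θ := by
  have h := triAngle_triAngle (b := -(b / (a * d))) (inv_pos.2 ha) (inv_pos.2 hd) θ
  have e : -(-(b / (a * d)) / (a⁻¹ * d⁻¹)) = b := by field_simp
  rwa [inv_inv, inv_inv, e] at h

lemma continuousOn_triAngle {X : Type*} [TopologicalSpace X] {S : Set X} {a b d θ : X → ℝ}
    (ha : ContinuousOn a S) (hb : ContinuousOn b S) (hd : ContinuousOn d S)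
    (hθ : ContinuousOn θ S) (ha0 : ∀ x ∈ S, 0 < a x) (hd0 : ∀ x ∈ S, 0 < d x) :
    ContinuousOn (fun x => triAngle (a x) (b x) (d x) (θ x)) S := by
  have htri : ContinuousOn (fun x => tri (a x) (b x) (d x) (θ x)) S := by
    have e : (fun x => tri (a x) (b x) (d x) (θ x)) = fun x =>
        ((a x * Real.cos (θ x) + b x * Real.sin (θ x) : ℝ) : ℂ)
          + ((d x * Real.sin (θ x) : ℝ) : ℂ) * Complex.I := by
      funext x; apply Complex.ext <;> simp [tri, Complex.cos_ofReal_re, Complex.sin_ofReal_re]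
    rw [e]
    have hc := Real.continuous_cos.comp_continuousOn hθ
    have hs := Real.continuous_sin.comp_continuousOn hθ
    exact (Complex.continuous_ofReal.comp_continuousOn ((ha.mul hc).add (hb.mul hs))).add
      ((Complex.continuous_ofReal.comp_continuousOn (hd.mul hs)).mul continuousOn_const)
  have hexp : ContinuousOn (fun x => Complex.exp (-((θ x : ℂ) * Complex.I))) S :=
    Complex.continuous_exp.comp_continuousOn
      ((Complex.continuous_ofReal.comp_continuousOn hθ).mul continuousOn_const).neg
  refine hθ.add fun x hx => ?_
  exact ContinuousAt.comp_continuousWithinAt (g := Complex.arg)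
    (f := fun x => tri (a x) (b x) (d x) (θ x) * Complex.exp (-((θ x : ℂ) * Complex.I)))
    (Complex.continuousAt_arg (tri_mul_exp_mem_slitPlane (ha0 x hx) (hd0 x hx) _))
    ((htri.mul hexp) x hx)

end

section

/-! ### Principal angles along loops -/

variable {g : E2 → E3}

lemma dir_ne_zero (t : ℝ) : dir t ≠ 0 := by
  intro h
  have h1 := congrArg (fun z : E2 => z 0) h
  have h2 := congrArg (fun z : E2 => z 1) h
  simp [dir] at h1 h2
  have := Real.sin_sq_add_cos_sq t
  simp [h1, h2] at this

lemma IsImmersion.coframe_dir (hg : IsImmersion g) (u : E2) (t : ℝ) :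
    coframe g u (dir t) =
      tri (coframe g u ex).re (coframe g u ey).re (coframe g u ey).im t := by
  have h := hg.coframe_ex_im u
  rw [coframe_apply]
  apply Complex.ext
  · simp [tri, dir, Complex.cos_ofReal_re, Complex.sin_ofReal_re]; ring
  · simp [tri, dir, h, Complex.sin_ofReal_re]; ring

/-- The angle, in the adapted frame, of the direction `dir t` of the parameter plane. -/
def frameAngle (g : E2 → E3) (u : E2) (t : ℝ) : ℝ :=
  triAngle (coframe g u ex).re (coframe g u ey).re (coframe g u ey).im t

/-- The angle in the parameter plane of the tangent vector with angle `τ` in the frame. -/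
def paramAngle (g : E2 → E3) (u : E2) (τ : ℝ) : ℝ :=
  triAngle (coframe g u ex).re⁻¹ (-((coframe g u ey).re / ((coframe g u ex).re * (coframe g u ey).im)))
    (coframe g u ey).im⁻¹ τ

namespace IsImmersion

lemma frameAngle_paramAngle (hg : IsImmersion g) (u : E2) (τ : ℝ) :
    frameAngle g u (paramAngle g u τ) = τ :=
  triAngle_triAngle_inv (hg.coframe_ex_pos u) (hg.coframe_ey_im u) τ

lemma paramAngle_frameAngle (hg : IsImmersion g) (u : E2) (t : ℝ) :
    paramAngle g u (frameAngle g u t) = t :=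
  triAngle_triAngle (hg.coframe_ex_pos u) (hg.coframe_ey_im u) t

lemma continuous_coframe_parts (hg : IsImmersion g) :
    Continuous (fun u => (coframe g u ex).re) ∧ Continuous (fun u => (coframe g u ey).re) ∧
      Continuous (fun u => (coframe g u ey).im) :=
  ⟨Complex.continuous_re.comp (hg.contDiff_coframe ex).continuous,
    Complex.continuous_re.comp (hg.contDiff_coframe ey).continuous,
    Complex.continuous_im.comp (hg.contDiff_coframe ey).continuous⟩

lemma continuousOn_frameAngle (hg : IsImmersion g) {X : Type*} [TopologicalSpace X] {S : Set X}
    {γ : X → E2} {t : X → ℝ} (hγ : ContinuousOn γ S) (ht : ContinuousOn t S) :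
    ContinuousOn (fun x => frameAngle g (γ x) (t x)) S := by
  obtain ⟨ha, hb, hd⟩ := hg.continuous_coframe_parts
  exact continuousOn_triAngle (ha.comp_continuousOn hγ) (hb.comp_continuousOn hγ)
    (hd.comp_continuousOn hγ) ht (fun x _ => hg.coframe_ex_pos _) (fun x _ => hg.coframe_ey_im _)

lemma continuousOn_paramAngle (hg : IsImmersion g) {X : Type*} [TopologicalSpace X] {S : Set X}
    {γ : X → E2} {t : X → ℝ} (hγ : ContinuousOn γ S) (ht : ContinuousOn t S) :
    ContinuousOn (fun x => paramAngle g (γ x) (t x)) S := by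
  obtain ⟨ha, hb, hd⟩ := hg.continuous_coframe_parts
  have ha' := ha.comp_continuousOn hγ
  have hb' := hb.comp_continuousOn hγ
  have hd' := hd.comp_continuousOn hγ
  have h1 : ∀ x ∈ S, 0 < (coframe g (γ x) ex).re := fun x _ => hg.coframe_ex_pos _
  have h2 : ∀ x ∈ S, 0 < (coframe g (γ x) ey).im := fun x _ => hg.coframe_ey_im _
  exact continuousOn_triAngle (ha'.inv₀ fun x hx => (h1 x hx).ne')
    (hb'.div (ha'.mul hd') fun x hx => (mul_pos (h1 x hx) (h2 x hx)).ne').neg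
    (hd'.inv₀ fun x hx => (h2 x hx).ne') ht (fun x hx => inv_pos.2 (h1 x hx))
    (fun x hx => inv_pos.2 (h2 x hx))

/-- With `φ = exp l`, reality of `φ conj Z ^ 2` reads `sin (Im l - 2τ) = 0`. -/
lemma isPrincipalDirection_dir_iff (hg : IsImmersion g) {u : E2} {l : ℂ}
    (hl : Complex.exp l = hopfCoeff g u) (t : ℝ) :
    IsPrincipalDirection g u (dir t) ↔ ∃ k : ℤ, 2 * frameAngle g u t - l.im = Real.pi * k := by
  rw [hg.isPrincipalDirection_iff u (dir_ne_zero t), hg.coframe_dir, tri_eq_norm_mul_exp, ← hl]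
  have hr : 0 < ‖tri (coframe g u ex).re (coframe g u ey).re (coframe g u ey).im t‖ :=
    norm_pos_iff.2 (tri_ne_zero (hg.coframe_ex_pos u) (hg.coframe_ey_im u) t)
  rw [← frameAngle]
  set r := ‖tri (coframe g u ex).re (coframe g u ey).re (coframe g u ey).im t‖
  set τ := frameAngle g u t
  have h1 : Complex.exp l * conj ((r : ℂ) * Complex.exp (τ * Complex.I)) ^ 2 =
      ((Real.exp l.re * r ^ 2 : ℝ) : ℂ) * Complex.exp (((l.im - 2 * τ : ℝ) : ℂ) * Complex.I) := by
    rw [map_mul, Complex.conj_ofReal, ← Complex.exp_conj, map_mul, Complex.conj_ofReal, Complex.conj_I,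
      mul_pow, ← Complex.exp_nat_mul]
    conv_lhs => rw [← Complex.re_add_im l, Complex.exp_add]
    push_cast
    rw [show ((l.im : ℂ) - 2 * τ) * Complex.I = l.im * Complex.I + 2 * (τ * -Complex.I) by ring,
      Complex.exp_add]
    ring
  rw [h1, Complex.im_ofReal_mul, Complex.exp_ofReal_mul_I_im, mul_eq_zero]
  have h2 : Real.exp l.re * r ^ 2 ≠ 0 := by positivity
  rw [or_iff_right h2, Real.sin_eq_zero_iff]
  constructor
  · rintro ⟨n, hn⟩
    exact ⟨-n, by push_cast; linarith⟩
  · rintro ⟨n, hn⟩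
    exact ⟨-n, by push_cast; linarith⟩

/-- The total rotation of a principal direction along a loop is half that of the Hopf
coefficient. -/
lemma principalAngle_increment (hg : IsImmersion g) {γ : ℝ → E2}
    (hγ : ContinuousOn γ (Icc 0 (2 * Real.pi))) (hper : γ (2 * Real.pi) = γ 0) {w : ℤ}
    (hw : HasWinding (fun t => hopfCoeff g (γ t)) w) {θ : ℝ → ℝ}
    (hθ : ContinuousOn θ (Icc 0 (2 * Real.pi)))
    (hp : ∀ t ∈ Icc 0 (2 * Real.pi), IsPrincipalDirection g (γ t) (dir (θ t))) :
    θ (2 * Real.pi) - θ 0 = w * Real.pi := by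
  obtain ⟨L, hL, hexp, hinc⟩ := hw
  have hτ := hg.continuousOn_frameAngle hγ hθ
  have key := eq_of_continuousOn_of_int_mul isPreconnected_Icc
    (F := fun t => 2 * frameAngle g (γ t) (θ t) - (L t).im)
    ((continuousOn_const.mul hτ).sub (Complex.continuous_im.comp_continuousOn hL))
    Real.pi_ne_zero (fun t ht => (hg.isPrincipalDirection_dir_iff (hexp t ht) (θ t)).1 (hp t ht))
    two_pi_mem_period zero_mem_period
  have him := congrArg Complex.im hinc
  simp at him key
  -- Both ends lie over the same base point, where the passage between frame and parameter angles is
  -- invertible and commutes with adding multiples of `π`.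
  have h1 : frameAngle g (γ 0) (θ (2 * Real.pi)) = frameAngle g (γ 0) (θ 0) + w * Real.pi := by
    rw [hper] at key; linarith
  rw [frameAngle, frameAngle, ← triAngle_add_int_mul_pi, ← frameAngle, ← frameAngle] at h1
  have h2 := congrArg (paramAngle g (γ 0)) h1
  rw [hg.paramAngle_frameAngle, hg.paramAngle_frameAngle] at h2
  rw [h2]; ring

lemma exists_principalAngle (hg : IsImmersion g) {γ : ℝ → E2}
    (hγ : ContinuousOn γ (Icc 0 (2 * Real.pi))) {w : ℤ}
    (hw : HasWinding (fun t => hopfCoeff g (γ t)) w) :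
    ∃ θ : ℝ → ℝ, ContinuousOn θ (Icc 0 (2 * Real.pi)) ∧
      ∀ t ∈ Icc 0 (2 * Real.pi), IsPrincipalDirection g (γ t) (dir (θ t)) := by
  obtain ⟨L, hL, hexp, -⟩ := hw
  -- In the frame, half the argument of `φ` is a principal angle.
  refine ⟨fun t => paramAngle g (γ t) ((L t).im / 2), hg.continuousOn_paramAngle hγ
    ((Complex.continuous_im.comp_continuousOn hL).div_const 2), fun t ht => ?_⟩
  refine (hg.isPrincipalDirection_dir_iff (hexp t ht) _).2 ⟨0, ?_⟩
  rw [hg.frameAngle_paramAngle]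
  push_cast; ring

lemma exists_local_principalAngle (hg : IsImmersion g) {U : Set E2} (hU : IsOpen U)
    (hc : Convex ℝ U) (hne : U.Nonempty) (h0 : ∀ u ∈ U, hopfCoeff g u ≠ 0) :
    ∃ ψ : E2 → ℝ, ContinuousOn ψ U ∧ ∀ u ∈ U, IsPrincipalDirection g u (dir (ψ u)) := by
  obtain ⟨L, hL, hexp⟩ := exists_continuous_log hU hc hne
    hg.contDiff_hopfCoeff.continuous.continuousOn h0
  refine ⟨fun u => paramAngle g u ((L u).im / 2), hg.continuousOn_paramAngle continuousOn_id
    ((Complex.continuous_im.comp_continuousOn hL).div_const 2), fun t ht => ?_⟩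
  refine (hg.isPrincipalDirection_dir_iff (hexp t ht) _).2 ⟨0, ?_⟩
  rw [hg.frameAngle_paramAngle]
  push_cast; ring

end IsImmersion

/-! ### Elliptic loops -/

/-- The ellipse that is the image of the unit circle under `!![a, b; 0, d]`. -/
def ellipse (a b d t : ℝ) : E2 := !₂[a * Real.cos t + b * Real.sin t, d * Real.sin t]

lemma ellipse_ne_zero {a b d : ℝ} (ha : 0 < a) (hd : 0 < d) (t : ℝ) : ellipse a b d t ≠ 0 := by
  intro h
  have h1 := congrArg (fun z : E2 => z 0) h
  have h2 := congrArg (fun z : E2 => z 1) h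
  simp [ellipse, hd.ne'] at h1 h2
  simp [h2, ha.ne'] at h1
  have := Real.sin_sq_add_cos_sq t
  simp [h1, h2] at this

lemma ellipse_lerp (a b d a' b' d' s t : ℝ) :
    ellipse ((1 - s) * a + s * a') ((1 - s) * b + s * b') ((1 - s) * d + s * d') t =
      (1 - s) • ellipse a b d t + s • ellipse a' b' d' t := by
  ext i; fin_cases i <;> simp [ellipse] <;> ring

lemma continuous_ellipse {X : Type*} [TopologicalSpace X] {a b d t : X → ℝ} (ha : Continuous a)
    (hb : Continuous b) (hd : Continuous d) (ht : Continuous t) :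
    Continuous fun x => ellipse (a x) (b x) (d x) (t x) := by
  rw [(PiLp.homeomorph 2 (fun _ : Fin 2 => ℝ)).isEmbedding.continuous_iff, continuous_pi_iff]
  intro i
  fin_cases i
  · exact (ha.mul (Real.continuous_cos.comp ht)).add (hb.mul (Real.continuous_sin.comp ht))
  · exact hd.mul (Real.continuous_sin.comp ht)

lemma circle_eq_ellipse (r t : ℝ) : r • dir t = ellipse r 0 r t := by
  ext i; fin_cases i <;> simp [ellipse, dir]

lemma norm_dir (t : ℝ) : ‖dir t‖ = 1 := by
  rw [EuclideanSpace.norm_eq]; simp [dir, Fin.sum_univ_two]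

/-- All elliptic loops in a punctured disc have the same winding number under a nonvanishing
function. -/
lemma exists_common_winding {φ : E2 → ℂ} (hφ : Continuous φ) {R : ℝ}
    (h0 : ∀ u, u ≠ 0 → ‖u‖ < R → φ u ≠ 0) {a b d a' b' d' : ℝ} (ha : 0 < a) (hd : 0 < d)
    (ha' : 0 < a') (hd' : 0 < d') (hR : ∀ t, ‖ellipse a b d t‖ < R)
    (hR' : ∀ t, ‖ellipse a' b' d' t‖ < R) :
    ∃ w : ℤ, HasWinding (fun t => φ (ellipse a b d t)) w ∧
      HasWinding (fun t => φ (ellipse a' b' d' t)) w := by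
  -- Clamping the parameter makes the homotopy defined and nonvanishing for every real `s`.
  let c : ℝ → ℝ := fun s => (projIcc (0 : ℝ) 1 zero_le_one s : ℝ)
  have hc : Continuous c := continuous_subtype_val.comp continuous_projIcc
  have hc0 : ∀ s, 0 ≤ c s := fun s => (projIcc (0 : ℝ) 1 zero_le_one s).2.1
  have hc1 : ∀ s, c s ≤ 1 := fun s => (projIcc (0 : ℝ) 1 zero_le_one s).2.2
  have e0 : c 0 = 0 := by simp [c]
  have e1 : c 1 = 1 := by simp [c]
  let H : ℝ × ℝ → ℂ := fun x => φ (ellipse ((1 - c x.1) * a + c x.1 * a')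
    ((1 - c x.1) * b + c x.1 * b') ((1 - c x.1) * d + c x.1 * d') x.2)
  -- Convex combinations of triangular matrices with positive diagonal keep a positive diagonal, so
  -- no intermediate ellipse meets the origin.
  have hpos : ∀ s x y : ℝ, 0 < x → 0 < y → 0 < (1 - c s) * x + c s * y := by
    intro s x y hx hy
    rcases eq_or_lt_of_le (hc0 s) with h | h
    · rw [← h]; simpa using hx
    · have := mul_pos h hy
      have := mul_nonneg (sub_nonneg.2 (hc1 s)) hx.le
      linarith
  have hH : Continuous H := by
    have := hc.comp (continuous_fst (X := ℝ) (Y := ℝ))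
    exact hφ.comp (continuous_ellipse (by fun_prop) (by fun_prop) (by fun_prop) continuous_snd)
  have hne : ∀ x, H x ≠ 0 := by
    intro x
    refine h0 _ (ellipse_ne_zero (hpos _ _ _ ha ha') (hpos _ _ _ hd hd') _) ?_
    rw [ellipse_lerp]
    have := convex_ball (0 : E2) R (by simpa using hR x.2) (by simpa using hR' x.2)
      (sub_nonneg.2 (hc1 x.1)) (hc0 x.1) (by ring)
    simpa using this
  obtain ⟨w, hw⟩ := HasWinding.of_homotopy hH hne (fun s => by simp [H, ellipse])
  refine ⟨w, ?_, ?_⟩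
  · simpa [H, e0] using hw 0
  · simpa [H, e1] using hw 1

end

section

/-! ### Bounded solutions of a perturbed Cauchy–Riemann equation in polar coordinates -/

/-- Near `0` the function `exp (C r) I + (c / 2) log r` is decreasing, so `exp (C r) I` is at least
a constant minus `(c / 2) log r`. That tends to `+∞` as `r → 0`, contradicting `I ≤ 0`. -/
lemma not_deriv_le_neg_div {I I' : ℝ → ℝ} {R c C : ℝ} (hR : 0 < R) (hc : 0 < c) (hC : 0 ≤ C)
    (hI : ∀ r ∈ Ioo 0 R, HasDerivAt I (I' r) r) (hneg : ∀ r ∈ Ioo 0 R, I r ≤ 0)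
    (hle : ∀ r ∈ Ioo 0 R, r * I' r ≤ -c + C * r - C * r * I r) : False := by
  obtain ⟨r₁, h0, h1, h2⟩ : ∃ r₁, 0 < r₁ ∧ r₁ < R ∧ C * r₁ ≤ c / 2 := by
    -- Below this radius the error `C r` consumes at most half of `c`.
    refine ⟨min (R / 2) (c / (2 * (C + 1))), by positivity, ?_, ?_⟩
    · exact (min_le_left _ _).trans_lt (by linarith)
    · calc C * min (R / 2) (c / (2 * (C + 1))) ≤ C * (c / (2 * (C + 1))) := by
            gcongr; exact min_le_right _ _
        _ ≤ (C + 1) * (c / (2 * (C + 1))) := by gcongr; linarith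
        _ = c / 2 := by field_simp
  let J : ℝ → ℝ := fun r => Real.exp (C * r) * I r + c / 2 * Real.log r
  have hJ : ∀ r ∈ Ioo 0 R, HasDerivAt J
      (Real.exp (C * r) * (C * 1) * I r + Real.exp (C * r) * I' r + c / 2 * r⁻¹) r := fun r hr =>
    ((((hasDerivAt_id r).const_mul C).exp).mul (hI r hr)).add
      ((Real.hasDerivAt_log hr.1.ne').const_mul _)
  have hanti : AntitoneOn J (Ioc 0 r₁) := by
    refine antitoneOn_of_deriv_nonpos (convex_Ioc 0 r₁)
      (fun r hr => (hJ r ⟨hr.1, hr.2.trans_lt h1⟩).continuousAt.continuousWithinAt) ?_ ?_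
    · intro r hr
      rw [interior_Ioc] at hr
      exact (hJ r ⟨hr.1, hr.2.trans h1⟩).differentiableAt.differentiableWithinAt
    · intro r hr
      rw [interior_Ioc] at hr
      have hr' : r ∈ Ioo 0 R := ⟨hr.1, hr.2.trans h1⟩
      rw [(hJ r hr').deriv]
      have hr0 := hr.1
      have e1 := hle r hr'
      have e2 : C * r ≤ c / 2 := (mul_le_mul_of_nonneg_left hr.2.le hC).trans h2
      have e3 : 1 ≤ Real.exp (C * r) := Real.one_le_exp (by positivity)
      have e4 : r * (I' r + C * I r) ≤ -(c / 2) := by nlinarith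
      have e5 : Real.exp (C * r) * (r * (I' r + C * I r)) ≤ -(c / 2) := by nlinarith
      have e6 : Real.exp (C * r) * (C * 1) * I r + Real.exp (C * r) * I' r + c / 2 * r⁻¹ =
          (Real.exp (C * r) * (r * (I' r + C * I r)) + c / 2) / r := by
        field_simp; ring
      rw [e6]
      exact div_nonpos_of_nonpos_of_nonneg (by linarith) hr0.le
  -- Chosen so that `(c / 2) log s ≤ J r₁ - c / 2`, while monotonicity gives `J r₁ ≤ J s ≤ (c / 2)
  -- log s`.
  set s := min r₁ (Real.exp (2 * J r₁ / c - 1)) with hs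
  have hs0 : 0 < s := lt_min h0 (Real.exp_pos _)
  have hs1 : s ≤ r₁ := min_le_left _ _
  have h3 := hanti ⟨hs0, hs1⟩ ⟨h0, le_rfl⟩ hs1
  have h4 : Real.log s ≤ 2 * J r₁ / c - 1 := by
    rw [Real.log_le_iff_le_exp hs0]
    exact min_le_right _ _
  have h5 : Real.exp (C * s) * I s ≤ 0 :=
    mul_nonpos_of_nonneg_of_nonpos (Real.exp_pos _).le (hneg s ⟨hs0, hs1.trans_lt h1⟩)
  have h6 : c / 2 * Real.log s ≤ J r₁ - c / 2 := by
    calc c / 2 * Real.log s ≤ c / 2 * (2 * J r₁ / c - 1) := by gcongr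
      _ = J r₁ - c / 2 := by field_simp
  have h7 : J s = Real.exp (C * s) * I s + c / 2 * Real.log s := rfl
  linarith

lemma hasDerivAt_integral_of_continuousOn {R a b : ℝ} (hab : a ≤ b) {F F' : ℝ → ℝ → ℝ}
    (hF : ContinuousOn (fun x : ℝ × ℝ => F x.1 x.2) (Ioo 0 R ×ˢ Icc a b))
    (hF' : ContinuousOn (fun x : ℝ × ℝ => F' x.1 x.2) (Ioo 0 R ×ˢ Icc a b))
    (hd : ∀ r ∈ Ioo 0 R, ∀ t ∈ Icc a b, HasDerivAt (fun r => F r t) (F' r t) r)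
    {r : ℝ} (hr : r ∈ Ioo 0 R) :
    HasDerivAt (fun r => ∫ t in a..b, F r t) (∫ t in a..b, F' r t) r := by
  have hsl : ∀ {G : ℝ → ℝ → ℝ}, ContinuousOn (fun x : ℝ × ℝ => G x.1 x.2) (Ioo 0 R ×ˢ Icc a b) →
      ∀ s ∈ Ioo 0 R, ContinuousOn (G s) (Icc a b) := fun hG s hs =>
    hG.comp (f := fun t => (s, t)) (by fun_prop) (fun t ht => ⟨hs, ht⟩)
  obtain ⟨C, hC⟩ := (isCompact_Icc.prod isCompact_Icc :
    IsCompact (Icc (r / 2) ((r + R) / 2) ×ˢ Icc a b)).exists_bound_of_continuousOn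
    (hF'.mono (prod_mono (fun x hx => ⟨by have := hx.1; have := hr.1; linarith,
      by have := hx.2; have := hr.2; linarith⟩) le_rfl))
  have hnhds : Ioo (r / 2) ((r + R) / 2) ∈ 𝓝 r :=
    Ioo_mem_nhds (by have := hr.1; linarith) (by have := hr.2; linarith)
  have hsub : ∀ x ∈ Ioo (r / 2) ((r + R) / 2), x ∈ Ioo 0 R := fun x hx =>
    ⟨by have := hx.1; have := hr.1; linarith, by have := hx.2; have := hr.2; linarith⟩
  have huI : uIoc a b ⊆ Icc a b := by rw [uIoc_of_le hab]; exact Ioc_subset_Icc_self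
  refine (intervalIntegral.hasDerivAt_integral_of_dominated_loc_of_deriv_le (F' := F')
    (bound := fun _ => C) hnhds ?_ ?_ ?_ ?_ ?_ ?_).2
  · filter_upwards [hnhds] with x hx
    exact ((hsl hF x (hsub x hx)).mono huI).aestronglyMeasurable measurableSet_uIoc
  · exact (hsl hF r hr).intervalIntegrable_of_Icc hab
  · exact ((hsl hF' r hr).mono huI).aestronglyMeasurable measurableSet_uIoc
  · exact Eventually.of_forall fun t ht x hx => hC (x, t) ⟨Ioo_subset_Icc_self hx, huI ht⟩
  · exact intervalIntegrable_const
  · exact Eventually.of_forall fun t ht x hx => hd x (hsub x hx) t (huI ht)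

/-- A nonpositive function on a punctured disc, in polar coordinates, cannot have
positive flux towards the origin. -/
lemma flux_nonpos {R C c : ℝ} (hR : 0 < R) (hc : 0 < c) (hC : 0 ≤ C)
    {p pr q qt U Ur Ut A : ℝ → ℝ → ℝ}
    (hp : ∀ r ∈ Ioo 0 R, ∀ t ∈ Icc 0 (2 * Real.pi), HasDerivAt (fun r => p r t) (pr r t) r)
    (hU : ∀ r ∈ Ioo 0 R, ∀ t ∈ Icc 0 (2 * Real.pi), HasDerivAt (fun r => U r t) (Ur r t) r)
    (hUt : ∀ r ∈ Ioo 0 R, ∀ t ∈ Icc 0 (2 * Real.pi), HasDerivAt (U r) (Ut r t) t)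
    (hq : ∀ r ∈ Ioo 0 R, ∀ t ∈ Icc 0 (2 * Real.pi), HasDerivAt (q r) (qt r t) t)
    (hpc : ContinuousOn (fun x : ℝ × ℝ => p x.1 x.2) (Ioo 0 R ×ˢ Icc 0 (2 * Real.pi)))
    (hprc : ContinuousOn (fun x : ℝ × ℝ => pr x.1 x.2) (Ioo 0 R ×ˢ Icc 0 (2 * Real.pi)))
    (hUc : ContinuousOn (fun x : ℝ × ℝ => U x.1 x.2) (Ioo 0 R ×ˢ Icc 0 (2 * Real.pi)))
    (hUrc : ContinuousOn (fun x : ℝ × ℝ => Ur x.1 x.2) (Ioo 0 R ×ˢ Icc 0 (2 * Real.pi)))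
    (hUtc : ContinuousOn (fun x : ℝ × ℝ => Ut x.1 x.2) (Ioo 0 R ×ˢ Icc 0 (2 * Real.pi)))
    (hqc : ContinuousOn (fun x : ℝ × ℝ => q x.1 x.2) (Ioo 0 R ×ˢ Icc 0 (2 * Real.pi)))
    (hqtc : ContinuousOn (fun x : ℝ × ℝ => qt x.1 x.2) (Ioo 0 R ×ˢ Icc 0 (2 * Real.pi)))
    (hAc : ContinuousOn (fun x : ℝ × ℝ => A x.1 x.2) (Ioo 0 R ×ˢ Icc 0 (2 * Real.pi)))
    (hUper : ∀ r ∈ Ioo 0 R, U r (2 * Real.pi) = U r 0)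
    (hqper : ∀ r ∈ Ioo 0 R, q r (2 * Real.pi) = q r 0)
    (hUneg : ∀ r ∈ Ioo 0 R, ∀ t ∈ Icc 0 (2 * Real.pi), U r t ≤ 0)
    (hp2 : ∀ r ∈ Ioo 0 R, ∀ t ∈ Icc 0 (2 * Real.pi), 1 / 2 ≤ p r t)
    (hprb : ∀ r ∈ Ioo 0 R, ∀ t ∈ Icc 0 (2 * Real.pi), |pr r t| ≤ C)
    (hqtb : ∀ r ∈ Ioo 0 R, ∀ t ∈ Icc 0 (2 * Real.pi), |qt r t| ≤ C * r)
    (heq : ∀ r ∈ Ioo 0 R, ∀ t ∈ Icc 0 (2 * Real.pi),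
      r * (p r t * Ur r t) + A r t + q r t * Ut r t ≤ C * r)
    (hA : ∀ r ∈ Ioo 0 R, ∫ t in (0 : ℝ)..(2 * Real.pi), A r t = c) : False := by
  have hpi : (0 : ℝ) ≤ 2 * Real.pi := by positivity
  have hII : ∀ {G : ℝ → ℝ → ℝ},
      ContinuousOn (fun x : ℝ × ℝ => G x.1 x.2) (Ioo 0 R ×ˢ Icc 0 (2 * Real.pi)) →
      ∀ s ∈ Ioo 0 R, IntervalIntegrable (G s) MeasureTheory.volume 0 (2 * Real.pi) :=
    fun hG s hs => ContinuousOn.intervalIntegrable_of_Icc hpi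
      (hG.comp (f := fun t => (s, t)) (by fun_prop) (fun t ht => ⟨hs, ht⟩))
  have hId := fun r hr => hasDerivAt_integral_of_continuousOn (r := r) hpi
    (F := fun r t => p r t * U r t) (F' := fun r t => pr r t * U r t + p r t * Ur r t)
    (hpc.mul hUc) ((hprc.mul hUc).add (hpc.mul hUrc))
    (fun r hr t ht => (hp r hr t ht).mul (hU r hr t ht)) hr
  have hInonpos : ∀ r ∈ Ioo 0 R, ∫ t in (0 : ℝ)..(2 * Real.pi), p r t * U r t ≤ 0 := by
    intro r hr
    have := intervalIntegral.integral_nonneg (f := fun t => -(p r t * U r t)) (μ := MeasureTheory.volume) hpi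
      fun t ht => neg_nonneg.2 <|
        mul_nonpos_of_nonneg_of_nonpos (by linarith [hp2 r hr t ht]) (hUneg r hr t ht)
    rw [intervalIntegral.integral_neg] at this
    linarith
  -- Applied to `I r = ∫ p U`. The `2πC` is the integral of the inhomogeneous bound; the `4C` pays
  -- for the terms `p_r U` and `q_t U`, each costing `2C` because `p ≥ 1/2`.
  refine not_deriv_le_neg_div (C := 2 * Real.pi * C + 4 * C) hR hc (by positivity) hId ?_ ?_
  · exact hInonpos
  · intro r hr
    have hr0 := hr.1
    have hI0 := hInonpos r hr
    -- Integration by parts over a period trades the uncontrolled `q U_t` for `-q_t U`, which is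
    -- small since `q_t = O(r)`.
    have hqU : ∫ t in (0 : ℝ)..(2 * Real.pi), (qt r t * U r t + q r t * Ut r t) = 0 := by
      rw [intervalIntegral.integral_eq_sub_of_hasDerivAt (f := fun t => q r t * U r t)]
      · simp [hUper r hr, hqper r hr]
      · intro t ht
        rw [uIcc_of_le hpi] at ht
        exact (hq r hr t ht).mul (hUt r hr t ht)
      · exact hII (G := fun r t => qt r t * U r t + q r t * Ut r t)
          ((hqtc.mul hUc).add (hqc.mul hUtc)) r hr
    have i1 := hII (G := fun r t => r * (pr r t * U r t + p r t * Ur r t))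
      (continuousOn_fst.mul ((hprc.mul hUc).add (hpc.mul hUrc))) r hr
    have i2 := hII hAc r hr
    have i3 := hII (G := fun r t => qt r t * U r t + q r t * Ut r t)
      ((hqtc.mul hUc).add (hqc.mul hUtc)) r hr
    have i4 := hII (G := fun r t => p r t * U r t) (hpc.mul hUc) r hr
    have hsum : r * (∫ t in (0 : ℝ)..(2 * Real.pi), (pr r t * U r t + p r t * Ur r t)) + c =
        ∫ t in (0 : ℝ)..(2 * Real.pi), (r * (pr r t * U r t + p r t * Ur r t) + A r t
          + (qt r t * U r t + q r t * Ut r t)) := by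
      rw [intervalIntegral.integral_add (i1.add i2) i3, intervalIntegral.integral_add i1 i2,
        hqU, hA r hr, intervalIntegral.integral_const_mul]
      ring
    have hmono : (∫ t in (0 : ℝ)..(2 * Real.pi), (r * (pr r t * U r t + p r t * Ur r t) + A r t
          + (qt r t * U r t + q r t * Ut r t))) ≤
        ∫ t in (0 : ℝ)..(2 * Real.pi), (C * r - 4 * C * r * (p r t * U r t)) := by
      refine intervalIntegral.integral_mono_on hpi ((i1.add i2).add i3)
        (intervalIntegrable_const.sub (i4.const_mul _)) fun t ht => ?_
      have b1 := abs_le.1 (hprb r hr t ht)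
      have b2 := abs_le.1 (hqtb r hr t ht)
      have b3 := heq r hr t ht
      have b4 := hp2 r hr t ht
      have b5 := hUneg r hr t ht
      have c1 : r * (pr r t * U r t) ≤ C * r * (-U r t) := by
        have := mul_nonneg (mul_nonneg hr0.le (neg_nonneg.2 b5)) (by linarith [b1.1] : 0 ≤ C + pr r t)
        linarith
      have c2 : qt r t * U r t ≤ C * r * (-U r t) := by
        have := mul_nonneg (neg_nonneg.2 b5) (by linarith [b2.1] : 0 ≤ C * r + qt r t)
        linarith
      have c3 : C * r * (-U r t) ≤ 2 * C * r * (-(p r t * U r t)) := by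
        have := mul_nonneg (mul_nonneg (mul_nonneg hC hr0.le) (neg_nonneg.2 b5))
          (by linarith : 0 ≤ 2 * p r t - 1)
        linarith
      linarith
    rw [intervalIntegral.integral_sub intervalIntegrable_const (i4.const_mul _),
      intervalIntegral.integral_const_mul (4 * C * r) (fun t => p r t * U r t),
      intervalIntegral.integral_const] at hmono
    simp only [sub_zero, smul_eq_mul] at hmono
    have := mul_nonneg (mul_nonneg (mul_nonneg hpi hC) hr0.le) (neg_nonneg.2 hI0)
    have := mul_nonneg (mul_nonneg (mul_nonneg (by norm_num : (0:ℝ) ≤ 4) hC) hr0.le) (neg_nonneg.2 hI0)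
    have := mul_nonneg hC hr0.le
    nlinarith

end

/-! ### From the perturbed Cauchy–Riemann equation to the sign of the winding number. -/

section

lemma hasDerivAt_log_norm {F : ℝ → ℂ} {F' : ℂ} {t : ℝ} (hF : HasDerivAt F F' t) (h0 : F t ≠ 0) :
    HasDerivAt (fun s => Real.log ‖F s‖) (F' / F t).re t := by
  have h1 : HasDerivAt (fun s => F s / F t) (F' / F t) t := hF.div_const _
  have h2 := h1.clog_real (by rw [div_self h0]; exact Complex.one_mem_slitPlane)
  rw [div_self h0, div_one] at h2
  have h3 : HasDerivAt (fun s => (Complex.log (F s / F t)).re + Real.log ‖F t‖) (F' / F t).re t :=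
    (Complex.reCLM.hasFDerivAt.comp_hasDerivAt t h2).add_const _
  refine h3.congr_of_eventuallyEq ?_
  filter_upwards [hF.continuousAt.eventually_ne h0] with s hs
  rw [Complex.log_re, norm_div, Real.log_div (norm_ne_zero_iff.2 hs) (norm_ne_zero_iff.2 h0)]
  ring

lemma exists_bound_strip {E : Type*} [NormedAddCommGroup E] {F : ℝ × ℝ → E} (hF : Continuous F) :
    ∃ C, 0 ≤ C ∧ ∀ r ∈ Icc (0 : ℝ) 1, ∀ t ∈ Icc 0 (2 * Real.pi), ‖F (r, t)‖ ≤ C := by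
  obtain ⟨C, hC⟩ := (isCompact_Icc.prod isCompact_Icc :
    IsCompact (Icc (0 : ℝ) 1 ×ˢ Icc 0 (2 * Real.pi))).exists_bound_of_continuousOn hF.continuousOn
  exact ⟨max C 0, le_max_right _ _, fun r hr t ht => (hC (r, t) ⟨hr, ht⟩).trans (le_max_left _ _)⟩

variable {E : Type*} [NormedAddCommGroup E] [NormedSpace ℝ E]

lemma hasDerivAt_fst {F : ℝ × ℝ → E} {r t : ℝ} (hF : DifferentiableAt ℝ F (r, t)) :
    HasDerivAt (fun s => F (s, t)) (fderiv ℝ F (r, t) (1, 0)) r :=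
  hF.hasFDerivAt.comp_hasDerivAt (f := fun s : ℝ => (s, t)) r
    ((hasDerivAt_id r).prodMk (hasDerivAt_const r t))

lemma hasDerivAt_snd {F : ℝ × ℝ → E} {r t : ℝ} (hF : DifferentiableAt ℝ F (r, t)) :
    HasDerivAt (fun s => F (r, s)) (fderiv ℝ F (r, t) (0, 1)) t :=
  hF.hasFDerivAt.comp_hasDerivAt (f := fun s : ℝ => (r, s)) t
    ((hasDerivAt_const t r).prodMk (hasDerivAt_id t))

lemma contDiff_fderiv_const {F : ℝ × ℝ → E} (hF : ContDiff ℝ ∞ F) (v : ℝ × ℝ) :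
    ContDiff ℝ ∞ fun x => fderiv ℝ F x v :=
  (hF.fderiv_right (m := ∞) (by simp)).clm_apply contDiff_const

lemma exists_lipschitz_strip {F : ℝ × ℝ → E} (hF : ContDiff ℝ ∞ F) :
    ∃ C, 0 ≤ C ∧ ∀ r ∈ Icc (0 : ℝ) 1, ∀ t ∈ Icc 0 (2 * Real.pi),
      ‖fderiv ℝ F (r, t) (1, 0)‖ ≤ C ∧ ‖F (r, t) - F (0, t)‖ ≤ C * r := by
  obtain ⟨C, hC0, hC⟩ := exists_bound_strip (contDiff_fderiv_const hF (1, 0)).continuous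
  refine ⟨C, hC0, fun r hr t ht => ⟨hC r hr t ht, ?_⟩⟩
  have := (convex_Icc (0 : ℝ) 1).norm_image_sub_le_of_norm_hasDerivWithin_le
    (f := fun s => F (s, t)) (f' := fun s => fderiv ℝ F (s, t) (1, 0))
    (fun s _ => (hasDerivAt_fst (hF.differentiable (by simp) _)).hasDerivWithinAt)
    (fun s hs => hC s hs t ht) (left_mem_Icc.2 zero_le_one) hr
  simpa [abs_of_nonneg hr.1] using this

/-- A bounded nonvanishing solution, on a punctured disc, of a smooth perturbation of the
conjugate Cauchy–Riemann equation in polar coordinates has nonpositive winding number. -/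
lemma winding_nonpos {Ψ k e : ℝ × ℝ → ℂ} (hΨ : ContDiff ℝ ∞ Ψ) (hk : ContDiff ℝ ∞ k)
    (he : Continuous e) (hk0 : ∀ t, k (0, t) = 1) (hkper : ∀ r, k (r, 2 * Real.pi) = k (r, 0))
    (hΨper : ∀ r, Ψ (r, 2 * Real.pi) = Ψ (r, 0)) {R : ℝ} (hR : 0 < R)
    (hne : ∀ r ∈ Ioo 0 R, ∀ t, Ψ (r, t) ≠ 0) (hle : ∀ r ∈ Ioo 0 R, ∀ t, ‖Ψ (r, t)‖ ≤ 1)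
    (heq : ∀ r ∈ Ioo 0 R, ∀ t, r * fderiv ℝ Ψ (r, t) (1, 0) =
      Complex.I * k (r, t) * fderiv ℝ Ψ (r, t) (0, 1) + r * e (r, t) * Ψ (r, t))
    {w : ℤ} (hw : ∀ r ∈ Ioo 0 R, HasWinding (fun t => Ψ (r, t)) w) : w ≤ 0 := by
  by_contra! hwpos
  have hΨd : ∀ x, DifferentiableAt ℝ Ψ x := hΨ.differentiable (by simp)
  have hkd : ∀ x, DifferentiableAt ℝ k x := hk.differentiable (by simp)
  have hktc := contDiff_fderiv_const hk (0, 1)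
  obtain ⟨C₁, hC₁, hk₁⟩ := exists_lipschitz_strip hk
  obtain ⟨C₂, hC₂, hk₂⟩ := exists_lipschitz_strip hktc
  obtain ⟨C₃, hC₃, he₃⟩ := exists_bound_strip he
  -- Since `k` is constant on `r = 0`, its angular derivative is `O(r)`, as `flux_nonpos` demands of
  -- `q_t`.
  have hkt0 : ∀ t, fderiv ℝ k (0, t) (0, 1) = 0 := by
    intro t
    have h1 := hasDerivAt_snd (hkd (0, t))
    simp only [hk0] at h1
    exact h1.unique (hasDerivAt_const t 1)
  obtain ⟨R₁, hR₁, hR₁R, hR₁1, hR₁C⟩ :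
      ∃ R₁, 0 < R₁ ∧ R₁ ≤ R ∧ R₁ ≤ 1 ∧ C₁ * R₁ ≤ 1 / 2 := by
    refine ⟨min (min R 1) (1 / (2 * (C₁ + 1))), by positivity,
      (min_le_left _ _).trans (min_le_left _ _), (min_le_left _ _).trans (min_le_right _ _), ?_⟩
    calc C₁ * min (min R 1) (1 / (2 * (C₁ + 1))) ≤ C₁ * (1 / (2 * (C₁ + 1))) := by
          gcongr; exact min_le_right _ _
      _ ≤ (C₁ + 1) * (1 / (2 * (C₁ + 1))) := by gcongr; linarith
      _ = 1 / 2 := by field_simp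
  have hR' : ∀ r ∈ Ioo 0 R₁, r ∈ Ioo 0 R := fun r hr => ⟨hr.1, hr.2.trans_le hR₁R⟩
  have h01 : ∀ r ∈ Ioo 0 R₁, r ∈ Icc (0 : ℝ) 1 := fun r hr => ⟨hr.1.le, hr.2.le.trans hR₁1⟩
  have hkb : ∀ r ∈ Ioo 0 R₁, ∀ t ∈ Icc 0 (2 * Real.pi), 1 / 2 ≤ (k (r, t)).re ∧
      (k (r, t)).re ≤ 3 / 2 ∧ |(k (r, t)).im| ≤ 1 / 2 := by
    intro r hr t ht
    have h1 := (hk₁ r (h01 r hr) t ht).2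
    rw [hk0] at h1
    have h2 : C₁ * r ≤ 1 / 2 := (mul_le_mul_of_nonneg_left hr.2.le hC₁).trans hR₁C
    have h3 := abs_le.1 ((Complex.abs_re_le_norm _).trans (h1.trans h2))
    have h4 := (Complex.abs_im_le_norm _).trans (h1.trans h2)
    simp at h3 h4
    refine ⟨by linarith [h3.1], by linarith [h3.2], by simpa using h4⟩
  have hktb : ∀ r ∈ Ioo 0 R₁, ∀ t ∈ Icc 0 (2 * Real.pi),
      |(fderiv ℝ k (r, t) (0, 1)).re| ≤ C₂ * r ∧ |(fderiv ℝ k (r, t) (0, 1)).im| ≤ C₂ * r := by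
    intro r hr t ht
    have h1 := (hk₂ r (h01 r hr) t ht).2
    rw [hkt0, sub_zero] at h1
    exact ⟨(Complex.abs_re_le_norm _).trans h1, (Complex.abs_im_le_norm _).trans h1⟩
  set S : Set (ℝ × ℝ) := Ioo 0 R₁ ×ˢ Icc 0 (2 * Real.pi)
  have hkre : Continuous fun x => (k x).re := Complex.continuous_re.comp hk.continuous
  have hkim : Continuous fun x => (k x).im := Complex.continuous_im.comp hk.continuous
  have hkr' := (contDiff_fderiv_const hk (1, 0)).continuous
  have hkt' := hktc.continuous
  have hΨr' := (contDiff_fderiv_const hΨ (1, 0)).continuous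
  have hΨt' := (contDiff_fderiv_const hΨ (0, 1)).continuous
  have hkre0 : ∀ x ∈ S, (k x).re ≠ 0 := fun x hx => by
    have := (hkb x.1 hx.1 x.2 hx.2).1
    intro h
    rw [Prod.mk.eta, h] at this
    norm_num at this
  have hΨ0 : ∀ x ∈ S, Ψ x ≠ 0 := fun x hx => hne x.1 (hR' _ hx.1) x.2
  have hdivc : ∀ {G : ℝ × ℝ → ℂ}, Continuous G → ContinuousOn (fun x => G x / Ψ x) S := fun hG =>
    hG.continuousOn.div hΨ.continuous.continuousOn hΨ0
  -- Divide the equation by `Ψ`, take real parts and divide by `Re k`: the term `Im (Ψ_t / Ψ)` gets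
  -- coefficient one and integrates to exactly `2πw`. As `1/2 ≤ Re k ≤ 3/2`, the three summands of
  -- `C` bound `p_r`, `q_t / r` and `Re e / Re k` respectively.
  refine flux_nonpos (R := R₁) (C := 4 * C₁ + 8 * C₂ + 2 * C₃) (c := 2 * Real.pi * w)
    (p := fun r t => ((k (r, t)).re)⁻¹)
    (pr := fun r t => -(fderiv ℝ k (r, t) (1, 0)).re / (k (r, t)).re ^ 2)
    (q := fun r t => (k (r, t)).im / (k (r, t)).re)
    (qt := fun r t => ((fderiv ℝ k (r, t) (0, 1)).im * (k (r, t)).re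
      - (k (r, t)).im * (fderiv ℝ k (r, t) (0, 1)).re) / (k (r, t)).re ^ 2)
    (U := fun r t => Real.log ‖Ψ (r, t)‖)
    (Ur := fun r t => (fderiv ℝ Ψ (r, t) (1, 0) / Ψ (r, t)).re)
    (Ut := fun r t => (fderiv ℝ Ψ (r, t) (0, 1) / Ψ (r, t)).re)
    (A := fun r t => (fderiv ℝ Ψ (r, t) (0, 1) / Ψ (r, t)).im)
    hR₁ ?_ (by positivity) ?_ ?_ ?_ ?_ ?_ ?_ ?_ ?_ ?_ ?_ ?_ ?_ ?_ ?_ ?_ ?_ ?_ ?_ ?_ ?_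
  · have : (0 : ℝ) < w := by exact_mod_cast hwpos
    positivity
  · intro r hr t ht
    exact (Complex.reCLM.hasFDerivAt.comp_hasDerivAt r (hasDerivAt_fst (hkd (r, t)))).inv
      (hkre0 (r, t) ⟨hr, ht⟩)
  · intro r hr t ht
    exact hasDerivAt_log_norm (hasDerivAt_fst (hΨd (r, t))) (hΨ0 (r, t) ⟨hr, ht⟩)
  · intro r hr t ht
    exact hasDerivAt_log_norm (hasDerivAt_snd (hΨd (r, t))) (hΨ0 (r, t) ⟨hr, ht⟩)
  · intro r hr t ht
    have h1 := hasDerivAt_snd (hkd (r, t))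
    exact (Complex.imCLM.hasFDerivAt.comp_hasDerivAt t h1).div
      (Complex.reCLM.hasFDerivAt.comp_hasDerivAt t h1) (hkre0 (r, t) ⟨hr, ht⟩)
  · exact hkre.continuousOn.inv₀ hkre0
  · exact (Complex.continuous_re.comp hkr').neg.continuousOn.div (hkre.pow 2).continuousOn
      fun x hx => pow_ne_zero 2 (hkre0 x hx)
  · exact (continuous_norm.comp hΨ.continuous).continuousOn.log
      fun x hx => norm_ne_zero_iff.2 (hΨ0 x hx)
  · exact Complex.continuous_re.comp_continuousOn (hdivc hΨr')
  · exact Complex.continuous_re.comp_continuousOn (hdivc hΨt')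
  · exact hkim.continuousOn.div hkre.continuousOn hkre0
  · exact (((Complex.continuous_im.comp hkt').mul hkre).sub
      (hkim.mul (Complex.continuous_re.comp hkt'))).continuousOn.div (hkre.pow 2).continuousOn
      fun x hx => pow_ne_zero 2 (hkre0 x hx)
  · exact Complex.continuous_im.comp_continuousOn (hdivc hΨt')
  · intro r _
    simp only [hΨper]
  · intro r _
    simp only [hkper]
  · intro r hr t _
    exact Real.log_nonpos (norm_nonneg _) (hle r (hR' r hr) t)
  · intro r hr t ht
    obtain ⟨h1, h2, -⟩ := hkb r hr t ht
    rw [← one_div]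
    exact one_div_le_one_div_of_le (by linarith) (by linarith)
  · intro r hr t ht
    obtain ⟨h1, -, -⟩ := hkb r hr t ht
    have h3 := (Complex.abs_re_le_norm _).trans (hk₁ r (h01 r hr) t ht).1
    rw [abs_div, abs_neg, abs_of_nonneg (sq_nonneg (k (r, t)).re), div_le_iff₀ (by positivity)]
    have h4 : 1 / 4 ≤ (k (r, t)).re ^ 2 := by nlinarith
    calc _ ≤ C₁ := h3
      _ ≤ (4 * C₁ + 8 * C₂ + 2 * C₃) * (1 / 4) := by linarith
      _ ≤ _ := by gcongr
  · intro r hr t ht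
    obtain ⟨h1, h2, h3⟩ := hkb r hr t ht
    obtain ⟨h4, h5⟩ := hktb r hr t ht
    have hr0 := hr.1
    rw [abs_div, abs_of_nonneg (sq_nonneg (k (r, t)).re), div_le_iff₀ (by positivity)]
    have h6 : 1 / 4 ≤ (k (r, t)).re ^ 2 := by nlinarith
    calc _ ≤ |(fderiv ℝ k (r, t) (0, 1)).im| * |(k (r, t)).re|
          + |(k (r, t)).im| * |(fderiv ℝ k (r, t) (0, 1)).re| := by
            rw [← abs_mul, ← abs_mul]; exact abs_sub _ _
      _ ≤ C₂ * r * (3 / 2) + 1 / 2 * (C₂ * r) := by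
            rw [abs_of_nonneg (by linarith : 0 ≤ (k (r, t)).re)]
            gcongr
      _ ≤ (4 * C₁ + 8 * C₂ + 2 * C₃) * r * (1 / 4) := by
            have := mul_nonneg hC₁ hr0.le
            have := mul_nonneg hC₃ hr0.le
            linarith
      _ ≤ _ := by gcongr
  · intro r hr t ht
    obtain ⟨h1, h2, h3⟩ := hkb r hr t ht
    have hr0 := hr.1
    have h0 := hΨ0 (r, t) ⟨hr, ht⟩
    have h4 : (r : ℂ) * (fderiv ℝ Ψ (r, t) (1, 0) / Ψ (r, t)) =
        Complex.I * k (r, t) * (fderiv ℝ Ψ (r, t) (0, 1) / Ψ (r, t)) + r * e (r, t) := by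
      have := heq r (hR' r hr) t
      field_simp
      linear_combination this
    have h5 := congrArg Complex.re h4
    set X := fderiv ℝ Ψ (r, t) (1, 0) / Ψ (r, t)
    set Y := fderiv ℝ Ψ (r, t) (0, 1) / Ψ (r, t)
    simp at h5
    have h6 : (e (r, t)).re ≤ C₃ := (le_abs_self _).trans
      ((Complex.abs_re_le_norm _).trans (he₃ r (h01 r hr) t ht))
    have h7 : r * ((k (r, t)).re⁻¹ * X.re) + Y.im + (k (r, t)).im / (k (r, t)).re * Y.re =
        r * (e (r, t)).re / (k (r, t)).re := by
      have : (k (r, t)).re ≠ 0 := hkre0 (r, t) ⟨hr, ht⟩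
      field_simp
      linarith
    rw [h7, div_le_iff₀ (by linarith)]
    have h8 : r * (e (r, t)).re ≤ r * C₃ := by gcongr
    have h9 : (4 * C₁ + 8 * C₂ + 2 * C₃) * r * (1 / 2) ≤ (4 * C₁ + 8 * C₂ + 2 * C₃) * r * (k (r, t)).re := by
      gcongr
    have := mul_nonneg hC₁ hr0.le
    have := mul_nonneg hC₂ hr0.le
    linarith
  · intro r hr
    have h1 := (hw r (hR' r hr)).integral_eq (F' := fun t => fderiv ℝ Ψ (r, t) (0, 1))
      (fun t => hasDerivAt_snd (hΨd (r, t))) (hΨt'.comp (by fun_prop)) (hne r (hR' r hr))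
    have hc : Continuous fun t => fderiv ℝ Ψ (r, t) (0, 1) / Ψ (r, t) :=
      (hΨt'.comp (by fun_prop)).div (hΨ.continuous.comp (by fun_prop)) (hne r (hR' r hr))
    have h2 := Complex.imCLM.intervalIntegral_comp_comm (hc.intervalIntegrable (μ := MeasureTheory.volume) 0 (2 * Real.pi))
    simp only [Complex.imCLM_apply] at h2
    rw [h2, h1]
    simp
    ring

end

section

/-! ### The index at an umbilic of constant mean curvature -/

lemma smul_ellipse (r a b d t : ℝ) : r • ellipse a b d t = ellipse (r * a) (r * b) (r * d) t := by
  ext i; fin_cases i <;> simp [ellipse] <;> ring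

lemma ellipse_eq_cos_sin (a b d t : ℝ) : ellipse a b d t =
    Real.cos t • ellipse a b d 0 + Real.sin t • ellipse a b d (Real.pi / 2) := by
  ext i; fin_cases i <;> simp [ellipse] <;> ring

lemma norm_ellipse_le (a b d t : ℝ) :
    ‖ellipse a b d t‖ ≤ ‖ellipse a b d 0‖ + ‖ellipse a b d (Real.pi / 2)‖ := by
  rw [ellipse_eq_cos_sin]
  refine (norm_add_le _ _).trans ?_
  rw [norm_smul, norm_smul]
  exact add_le_add (mul_le_of_le_one_left (norm_nonneg _) (Real.abs_cos_le_one t))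
    (mul_le_of_le_one_left (norm_nonneg _) (Real.abs_sin_le_one t))

lemma hasDerivAt_ellipse (a b d t : ℝ) :
    HasDerivAt (ellipse a b d) (ellipse a b d (t + Real.pi / 2)) t := by
  have e : ellipse a b d = fun t =>
      Real.cos t • ellipse a b d 0 + Real.sin t • ellipse a b d (Real.pi / 2) :=
    funext fun t => ellipse_eq_cos_sin a b d t
  have h := ((Real.hasDerivAt_cos t).smul_const (ellipse a b d 0)).add
    ((Real.hasDerivAt_sin t).smul_const (ellipse a b d (Real.pi / 2)))
  rw [ellipse_eq_cos_sin a b d (t + _), Real.cos_add_pi_div_two, Real.sin_add_pi_div_two]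
  exact h.congr_of_eventuallyEq (EventuallyEq.of_eq e)

lemma contDiff_ellipse (a b d : ℝ) : ContDiff ℝ ∞ (ellipse a b d) := by
  have e : ellipse a b d = fun t =>
      Real.cos t • ellipse a b d 0 + Real.sin t • ellipse a b d (Real.pi / 2) :=
    funext fun t => ellipse_eq_cos_sin a b d t
  rw [e]
  exact (Real.contDiff_cos.smul contDiff_const).add (Real.contDiff_sin.smul contDiff_const)

variable {g : E2 → E3}

/-- The Hopf coefficient of a surface of constant mean curvature has nonpositive winding number
around an isolated zero. -/
lemma IsImmersion.winding_hopfCoeff_nonpos (hg : IsImmersion g) {R₀ : ℝ} (hR₀ : 0 < R₀) {c : ℂ}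
    (hH : ∀ u, ‖u‖ < R₀ → traceCoeff g u = c) (h0 : hopfCoeff g 0 = 0)
    (hne : ∀ u, u ≠ 0 → ‖u‖ < R₀ → hopfCoeff g u ≠ 0) {r₀ : ℝ} (hr₀ : r₀ ∈ Ioo 0 R₀) {w : ℤ}
    (hw : HasWinding (fun t => hopfCoeff g (r₀ • dir t)) w) : w ≤ 0 := by
  have hφ := hg.contDiff_hopfCoeff
  -- The matrix `!![a, b; 0, d]` inverts the coframe at the origin, so the coframe at `0` maps the
  -- ellipse to the unit circle. This replaces isothermal coordinates and yields `k (0, t) = 1`.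
  set a := (coframe g 0 ex).re⁻¹ with ha
  set b := -((coframe g 0 ey).re / ((coframe g 0 ex).re * (coframe g 0 ey).im)) with hb
  set d := (coframe g 0 ey).im⁻¹ with hd
  have ha0 : 0 < a := inv_pos.2 (hg.coframe_ex_pos 0)
  have hd0 : 0 < d := inv_pos.2 (hg.coframe_ey_im 0)
  set E : ℝ → E2 := ellipse a b d with hE
  have hEc : ContDiff ℝ ∞ E := contDiff_ellipse a b d
  set M := ‖E 0‖ + ‖E (Real.pi / 2)‖ with hM
  have hM0 : 0 ≤ M := by positivity
  -- The vanishing of `φ` at the umbilic serves only to make `log ‖φ‖` nonpositive nearby.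
  obtain ⟨R₁, hR₁, hφ1⟩ : ∃ R₁ > 0, ∀ u, ‖u‖ < R₁ → ‖hopfCoeff g u‖ ≤ 1 := by
    have h1 : ∀ᶠ u in 𝓝 (0 : E2), ‖hopfCoeff g u‖ < 1 :=
      (continuous_norm.comp hφ.continuous).continuousAt.eventually_lt continuousAt_const
        (by simp [h0])
    obtain ⟨R₁, hR₁, h2⟩ := Metric.eventually_nhds_iff_ball.1 h1
    exact ⟨R₁, hR₁, fun u hu => (h2 u (by simpa using hu)).le⟩
  set R := min R₀ R₁ / (M + 1) with hR
  have hRpos : 0 < R := by positivity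
  have hsmall : ∀ r ∈ Ioo 0 R, ∀ t, ‖r • E t‖ < min R₀ R₁ := by
    intro r hr t
    rw [norm_smul, Real.norm_of_nonneg hr.1.le]
    calc r * ‖E t‖ ≤ r * (M + 1) := by
          gcongr
          · exact hr.1.le
          · linarith [norm_ellipse_le a b d t]
      _ < R * (M + 1) := by gcongr; exact hr.2
      _ = min R₀ R₁ := by rw [hR]; field_simp
  have hE0 : ∀ t, E t ≠ 0 := ellipse_ne_zero ha0 hd0
  have hXc : ContDiff ℝ ∞ fun x : ℝ × ℝ => x.1 • E x.2 :=
    contDiff_fst.smul (hEc.comp contDiff_snd)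
  have hE2c : ContDiff ℝ ∞ fun x : ℝ × ℝ => E (x.2 + Real.pi / 2) :=
    hEc.comp (contDiff_snd.add contDiff_const)
  have hcoord : ∀ {F : ℝ × ℝ → E2}, ContDiff ℝ ∞ F → ∀ i, ContDiff ℝ ∞ fun x => F x i :=
    fun hF i => contDiff_euclidean.1 hF i
  have hZc : ∀ {V : ℝ × ℝ → E2}, ContDiff ℝ ∞ V →
      ContDiff ℝ ∞ fun x : ℝ × ℝ => conj (coframe g (x.1 • E x.2) (V x)) := by
    intro V hV
    refine Complex.conjCLE.contDiff.comp ?_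
    have e : (fun x : ℝ × ℝ => coframe g (x.1 • E x.2) (V x)) = fun x =>
        (V x 0 : ℂ) * coframe g (x.1 • E x.2) ex + (V x 1 : ℂ) * coframe g (x.1 • E x.2) ey :=
      funext fun x => coframe_apply _ _
    rw [e]
    exact ((Complex.ofRealCLM.contDiff.comp (hcoord hV 0)).mul ((hg.contDiff_coframe ex).comp hXc)).add
      ((Complex.ofRealCLM.contDiff.comp (hcoord hV 1)).mul ((hg.contDiff_coframe ey).comp hXc))
  have hcc : ∀ {V : ℝ × ℝ → E2}, ContDiff ℝ ∞ V →
      Continuous fun x : ℝ × ℝ => (conn g (x.1 • E x.2) (V x) : ℂ) := by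
    intro V hV
    refine Complex.continuous_ofReal.comp ?_
    have e : (fun x : ℝ × ℝ => conn g (x.1 • E x.2) (V x)) = fun x =>
        V x 0 * conn g (x.1 • E x.2) ex + V x 1 * conn g (x.1 • E x.2) ey :=
      funext fun x => conn_apply _ _
    rw [e]
    exact (((hcoord hV 0).mul ((hg.contDiff_conn ex).comp hXc)).add
      ((hcoord hV 1).mul ((hg.contDiff_conn ey).comp hXc))).continuous
  have hE1c : ContDiff ℝ ∞ fun x : ℝ × ℝ => E x.2 := hEc.comp contDiff_snd
  have hZne : ∀ x : ℝ × ℝ, conj (coframe g (x.1 • E x.2) (E (x.2 + Real.pi / 2))) ≠ 0 := fun x =>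
    (map_ne_zero _).2 (hg.coframe_ne_zero _ (hE0 _))
  set ρ : ℝ × ℝ → ℂ := fun x => conj (coframe g (x.1 • E x.2) (E x.2)) *
    (conj (coframe g (x.1 • E x.2) (E (x.2 + Real.pi / 2))))⁻¹ with hρ
  have hρc : ContDiff ℝ ∞ ρ := (hZc hE1c).mul ((hZc hE2c).inv hZne)
  have hZ0 : ∀ t, coframe g 0 (E t) = Complex.exp (t * Complex.I) := by
    intro t
    have h1 := hg.coframe_ex_im 0
    have h2 := (hg.coframe_ex_pos 0).ne'
    have h3 := (hg.coframe_ey_im 0).ne'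
    rw [coframe_apply]
    have e0 : (E t) 0 = a * Real.cos t + b * Real.sin t := rfl
    have e1 : (E t) 1 = d * Real.sin t := rfl
    apply Complex.ext
    · rw [Complex.add_re, Complex.re_ofReal_mul, Complex.re_ofReal_mul, Complex.exp_ofReal_mul_I_re,
        e0, e1, ha, hb, hd]
      field_simp
      ring
    · rw [Complex.add_im, Complex.im_ofReal_mul, Complex.im_ofReal_mul, Complex.exp_ofReal_mul_I_im,
        e0, e1, h1, hd]
      field_simp
      ring
  -- Codazzi is applied to `E` and its derivative `E'`, a quarter period ahead. Since `Ψ_r = dφ(E)`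
  -- and `Ψ_t = r dφ(E')`, it becomes `r Ψ_r = ρ Ψ_t + 2 i r (ρ ω(E') - ω(E)) Ψ`.
  refine winding_nonpos (Ψ := fun x => hopfCoeff g (x.1 • E x.2)) (k := fun x => -Complex.I * ρ x)
    (e := fun x => 2 * Complex.I * (ρ x * conn g (x.1 • E x.2) (E (x.2 + Real.pi / 2))
      - conn g (x.1 • E x.2) (E x.2)))
    (hφ.comp hXc) (contDiff_const.mul hρc)
    (continuous_const.mul ((hρc.continuous.mul (hcc hE2c)).sub (hcc hE1c))) ?_ ?_ ?_ hRpos ?_ ?_ ?_ ?_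
  · intro t
    simp only [hρ, zero_smul, hZ0]
    rw [← map_inv₀, ← map_mul, ← Complex.exp_neg, ← Complex.exp_add]
    have : (t : ℂ) * Complex.I + -(((t + Real.pi / 2 : ℝ) : ℂ) * Complex.I) = -(Real.pi / 2 * Complex.I) := by
      push_cast; ring
    rw [this, Complex.exp_neg, Complex.exp_pi_div_two_mul_I]
    simp
  · intro r
    have e1 : E (2 * Real.pi) = E 0 := by simp [hE, ellipse]
    have e2 : E (2 * Real.pi + Real.pi / 2) = E (0 + Real.pi / 2) := by
      rw [hE, ellipse, ellipse, add_comm (2 * Real.pi), Real.cos_add_two_pi, Real.sin_add_two_pi,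
        zero_add]
    simp only [hρ, e1, e2]
  · intro r
    simp [hE, ellipse]
  · intro r hr t
    exact hne _ (smul_ne_zero hr.1.ne' (hE0 t)) ((hsmall r hr t).trans_le (min_le_left _ _))
  · intro r hr t
    exact hφ1 _ ((hsmall r hr t).trans_le (min_le_right _ _))
  · intro r hr t
    have hφd := (hφ.differentiable (by simp) (r • E t)).hasFDerivAt
    have hd1 : HasDerivAt (fun s => s • E t) (E t) r := by
      simpa using (hasDerivAt_id r).smul_const (E t)
    have hd2 : HasDerivAt (fun s => r • E s) (r • E (t + Real.pi / 2)) t :=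
      (hasDerivAt_ellipse a b d t).const_smul r
    have hΨd : DifferentiableAt ℝ (fun x : ℝ × ℝ => hopfCoeff g (x.1 • E x.2)) (r, t) :=
      (hφ.comp hXc).differentiable (by simp) _
    have f1 := (hasDerivAt_fst hΨd).unique (hφd.comp_hasDerivAt (f := fun s => s • E t) r hd1)
    have f2 := (hasDerivAt_snd hΨd).unique (hφd.comp_hasDerivAt (f := fun s => r • E s) t hd2)
    have hev : traceCoeff g =ᶠ[𝓝 (r • E t)] fun _ => c := by
      have : Metric.ball (0 : E2) R₀ ∈ 𝓝 (r • E t) := Metric.isOpen_ball.mem_nhds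
        (by simpa using (hsmall r hr t).trans_le (min_le_left _ _))
      filter_upwards [this] with u hu
      exact hH u (by simpa using hu)
    have hcod := hg.codazzi_of_traceCoeff_const hev (E t) (E (t + Real.pi / 2))
    have hz := hZne (r, t)
    rw [f1, f2, map_smul, Complex.real_smul]
    simp only [hρ] at hz ⊢
    generalize E (t + Real.pi / 2) = W at hcod hz ⊢
    rw [← mul_assoc Complex.I (-Complex.I), show Complex.I * -Complex.I = 1 by simp]
    field_simp
    linear_combination (r : ℂ) * hcod
  · intro r hr
    obtain ⟨w', h1, h2⟩ := exists_common_winding hφ.continuous hne (a := r₀) (b := 0) (d := r₀)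
      (a' := r * a) (b' := r * b) (d' := r * d) hr₀.1 hr₀.1 (mul_pos hr.1 ha0) (mul_pos hr.1 hd0)
      (fun t => by
        rw [← circle_eq_ellipse, norm_smul, norm_dir, Real.norm_of_nonneg hr₀.1.le, mul_one]
        exact hr₀.2)
      (fun t => by
        rw [← smul_ellipse]; exact (hsmall r hr t).trans_le (min_le_left _ _))
    simp only [← circle_eq_ellipse, ← smul_ellipse] at h1 h2
    rw [hw.unique h1]
    exact h2

end

/-! ### Small circles around an umbilic of the sphere. -/

section

/-- Only the sign relating `n` to the frame normal could jump. The trace coefficient is continuous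
with values `±c`, hence constant on the disc; the case `c = 0` is immediate. -/
lemma traceCoeff_const_of_meanCurvature {g : E2 → E3} (hg : IsImmersion g) {R : ℝ} {n : E2 → E3}
    {c : ℝ} (hn : ∀ u, ‖u‖ < R → IsUnitNormal g u (n u))
    (hc : ∀ u, ‖u‖ < R → meanCurvatureParam g (n u) u = c) :
    ∃ k : ℂ, ∀ u, ‖u‖ < R → traceCoeff g u = k := by
  have hpm : ∀ u, ‖u‖ < R → ∃ m : ℤ, (traceCoeff g u).re = c * m := by
    intro u hu
    have h1 := hg.meanCurvatureParam_eq (hn u hu)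
    have h2 := (hg.normal_eq (hn u hu)).2
    rw [hc u hu] at h1
    rcases mul_self_eq_one_iff.1 ((sq _).symm.trans h2) with h | h
    · exact ⟨1, by rw [h] at h1; push_cast; linarith⟩
    · exact ⟨-1, by rw [h] at h1; push_cast; linarith⟩
  refine ⟨((traceCoeff g 0).re : ℂ), fun u hu => Complex.ext ?_ (by
    rw [hg.traceCoeff_im, Complex.ofReal_im])⟩
  rw [Complex.ofReal_re]
  have h0 : ‖(0 : E2)‖ < R := by
    rw [norm_zero]; exact (norm_nonneg u).trans_lt hu
  by_cases hc0 : c = 0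
  · obtain ⟨m, hm⟩ := hpm u hu
    obtain ⟨m', hm'⟩ := hpm 0 h0
    rw [hm, hm', hc0]; simp
  · exact eq_of_continuousOn_of_int_mul (convex_ball (0 : E2) R).isPreconnected
      (Complex.continuous_re.comp hg.contDiff_traceCoeff.continuous).continuousOn hc0
      (fun x hx => hpm x (by simpa using hx)) (by simpa using hu) (by simpa using h0)

lemma extChartAt_symm_center (p : S2) : (extChartAt (𝓡 2) p).symm 0 = p := by
  rw [← center_eq_zero p]
  exact extChartAt_to_inv p

lemma continuous_extChartAt_symm (p : S2) : Continuous (extChartAt (𝓡 2) p).symm := by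
  have := continuousOn_extChartAt_symm (I := 𝓡 2) p
  rwa [extChartAt_target_univ, ← continuousOn_univ.symm.eq] at this

lemma extChartAt_symm_ne (p : S2) {u : E2} (hu : u ≠ 0) : (extChartAt (𝓡 2) p).symm u ≠ p := by
  intro h
  apply hu
  have h1 := (extChartAt (𝓡 2) p).right_inv (x := u) (by rw [extChartAt_target_univ]; trivial)
  rw [← h1, h]
  exact center_eq_zero p

variable {f : S2 → E3}

/-- Around an isolated umbilic of constant mean curvature, the Hopf coefficient has nonpositive
winding number along small circles. -/
lemma exists_winding_nonpos (hf : ∀ x, IsImmersion (localParam f x)) {p : S2}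
    (hp : IsCMCUmbilic f p) (hiso : IsIsolatedUmbilic f p) :
    ∃ R : ℝ, 0 < R ∧ ∃ w : ℤ, w ≤ 0 ∧ (∀ r ∈ Ioo 0 R,
      HasWinding (fun t => hopfCoeff (localParam f p) (r • dir t)) w) := by
  obtain ⟨hum, ν, hν, r, hr, c, hc⟩ := hp
  have hg := hf p
  set g := localParam f p with hgdef
  set e := (extChartAt (𝓡 2) p).symm with he
  have hec : Continuous e := continuous_extChartAt_symm p
  have h1 : ∀ᶠ u in 𝓝 (0 : E2), e u ∈ Metric.closedBall p r :=
    hec.continuousAt.eventually (by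
      rw [he, extChartAt_symm_center]; exact Metric.closedBall_mem_nhds p hr)
  have h2 : ∀ᶠ u in 𝓝 (0 : E2), u ≠ 0 → ¬ IsUmbilic f (e u) := by
    have : Tendsto e (𝓝 0) (𝓝 p) := by
      have := hec.tendsto 0
      rwa [he, extChartAt_symm_center] at this
    have h3 := this.eventually (eventually_nhdsWithin_iff.1 hiso.2)
    exact h3.mono fun u hu hu0 => hu (extChartAt_symm_ne p hu0)
  obtain ⟨R, hR, hball⟩ := Metric.eventually_nhds_iff_ball.1 (h1.and h2)
  have hball' : ∀ u : E2, ‖u‖ < R → e u ∈ Metric.closedBall p r ∧ (u ≠ 0 → ¬ IsUmbilic f (e u)) :=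
    fun u hu => hball u (by simpa using hu)
  obtain ⟨k, hk⟩ := traceCoeff_const_of_meanCurvature hg (R := R) (n := fun u => ν (e u)) (c := c)
    (fun u _ => isUnitNormal_gauss hf hν p u)
    (fun u hu => by rw [← meanCurvature_eq hf hν p u]; exact hc _ (hball' u hu).1)
  have h0 : hopfCoeff g 0 = 0 := by
    rw [← hg.isUmbilicParam_iff, ← isUmbilic_iff hf, extChartAt_symm_center]
    exact hum
  have hne : ∀ u, u ≠ 0 → ‖u‖ < R → hopfCoeff g u ≠ 0 := by
    intro u hu hR h
    rw [← hg.isUmbilicParam_iff, ← isUmbilic_iff hf] at h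
    exact (hball' u hR).2 hu h
  have hcirc : ∀ r ∈ Ioo 0 R, ∀ t, ‖ellipse r 0 r t‖ < R := by
    intro r hr t
    rw [← circle_eq_ellipse, norm_smul, norm_dir, Real.norm_of_nonneg hr.1.le, mul_one]
    exact hr.2
  have hw : ∀ r ∈ Ioo 0 R, ∃ w : ℤ, HasWinding (fun t => hopfCoeff g (r • dir t)) w ∧
      HasWinding (fun t => hopfCoeff g ((R / 2) • dir t)) w := by
    intro r hr
    simp only [circle_eq_ellipse]
    exact exists_common_winding hg.contDiff_hopfCoeff.continuous hne hr.1 hr.1 (by positivity)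
      (by positivity) (hcirc r hr) (hcirc (R / 2) ⟨by positivity, by linarith⟩)
  have hR2 : R / 2 ∈ Ioo 0 R := ⟨by positivity, by linarith⟩
  obtain ⟨w, hw1, -⟩ := hw (R / 2) hR2
  refine ⟨R, hR, w, hg.winding_hopfCoeff_nonpos hR hk h0 hne hR2 hw1, fun r hr => ?_⟩
  obtain ⟨w', h3, h4⟩ := hw r hr
  rw [hw1.unique h4]
  exact h3

lemma continuous_circle (r : ℝ) : Continuous fun t => r • dir t := by
  simp only [circle_eq_ellipse]
  exact continuous_ellipse continuous_const continuous_const continuous_const continuous_id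

lemma circle_periodic (r : ℝ) : r • dir (2 * Real.pi) = r • dir 0 := by
  simp [dir]

/-- Every continuous principal angle along a small circle gains `wπ`, and one exists; together these
make the index well defined. -/
lemma hasUmbilicIndex_iff (hf : ∀ x, IsImmersion (localParam f x)) {p : S2} {R : ℝ} (hR : 0 < R)
    {w : ℤ} (hw : ∀ r ∈ Ioo 0 R, HasWinding (fun t => hopfCoeff (localParam f p) (r • dir t)) w)
    (i : ℝ) : HasUmbilicIndex f p i ↔ i = w / 2 := by
  have hnhds : ∀ᶠ r in 𝓝[>] (0 : ℝ), r ∈ Ioo 0 R := Ioo_mem_nhdsGT hR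
  simp only [HasUmbilicIndex, center_eq_zero, zero_add]
  constructor
  · intro h
    obtain ⟨r, ⟨θ, hθ, hp, hinc⟩, hr⟩ := (h.and hnhds).exists
    have := (hf p).principalAngle_increment (continuous_circle r).continuousOn (circle_periodic r)
      (hw r hr) hθ hp
    rw [hinc] at this
    have hpi := Real.pi_ne_zero
    field_simp at this ⊢
    linarith
  · rintro rfl
    filter_upwards [hnhds] with r hr
    obtain ⟨θ, hθ, hp⟩ := (hf p).exists_principalAngle (continuous_circle r).continuousOn (hw r hr)
    refine ⟨θ, hθ, hp, ?_⟩
    rw [(hf p).principalAngle_increment (continuous_circle r).continuousOn (circle_periodic r)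
      (hw r hr) hθ hp]
    ring

/-! ### The total index on the sphere -/

/-- Inversion of the parameter plane in the circle of radius two. -/
def invert (y : E2) : E2 := (4 / ‖y‖ ^ 2) • y

lemma contDiffAt_invert {y : E2} (hy : y ≠ 0) : ContDiffAt ℝ ∞ invert y :=
  (contDiffAt_const.div (contDiff_norm_sq ℝ).contDiffAt (by simpa using hy)).smul contDiffAt_id

lemma invert_circle {δ : ℝ} (hδ : 0 < δ) (t : ℝ) : invert (δ • dir t) = (4 / δ) • dir t := by
  rw [invert, norm_smul, norm_dir, Real.norm_of_nonneg hδ.le, mul_one, smul_smul]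
  congr 1
  field_simp

/-- At a point in direction `t`, inversion acts on vectors as a scaled reflection across the line
perpendicular to that direction. -/
lemma fderiv_invert_circle {δ : ℝ} (hδ : 0 < δ) (t s : ℝ) :
    fderiv ℝ invert (δ • dir t) (dir s) = (4 / δ ^ 2) • dir (2 * t + Real.pi - s) := by
  have hne : δ • dir t ≠ 0 := smul_ne_zero hδ.ne' (dir_ne_zero t)
  have hN : HasFDerivAt (fun y : E2 => ‖y‖ ^ 2) _ (δ • dir t) :=
    (hasStrictFDerivAt_norm_sq (δ • dir t)).hasFDerivAt
  have h0 : ‖δ • dir t‖ ^ 2 ≠ 0 := by simpa using hne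
  have hn : ‖δ • dir t‖ ^ 2 = δ ^ 2 := by
    rw [norm_smul, norm_dir, Real.norm_of_nonneg hδ.le, mul_one]
  have h1 := (((hasDerivAt_inv h0).comp_hasFDerivAt (f := fun y : E2 => ‖y‖ ^ 2) _ hN).const_mul 4).smul
    (hasFDerivAt_id (𝕜 := ℝ) (δ • dir t))
  have e : invert = fun y : E2 => (4 * (Inv.inv ∘ fun y : E2 => ‖y‖ ^ 2) y) • id y := by
    funext y; simp [invert, div_eq_mul_inv]
  rw [e]
  refine (congrArg (fun L => L (dir s)) h1.fderiv).trans ?_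
  have hin : inner ℝ (dir t) (dir s) = Real.cos (t - s) := by
    simp [dir, PiLp.inner_apply, Fin.sum_univ_two, Real.cos_sub]; ring
  have e1 : 2 * t + Real.pi - s = 2 * t - s + Real.pi := by ring
  have e2 : 2 * t - s = t + (t - s) := by ring
  have c1 : Real.cos s = Real.cos (t - (t - s)) := by congr 1; ring
  have c2 : Real.sin s = Real.sin (t - (t - s)) := by congr 1; ring
  simp only [add_apply, smul_apply, ContinuousLinearMap.smulRight_apply, Function.comp_apply, hn,
    innerSL_apply_apply, inner_smul_left, hin, RCLike.conj_to_real, id, ContinuousLinearMap.id_apply, smul_eq_mul, nsmul_eq_mul]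
  ext i
  fin_cases i
  · simp [dir, e1, Real.cos_add_pi]
    rw [e2, c1, Real.cos_add, Real.cos_sub]
    field_simp
    ring
  · simp [dir, e1, Real.sin_add_pi]
    rw [e2, c2, Real.sin_add, Real.sin_sub]
    field_simp
    ring

lemma isPrincipalDirection_of_smul {g : E2 → E3} {u v : E2} {c : ℝ} (hc : c ≠ 0)
    (h : IsPrincipalDirection g u (c • v)) : IsPrincipalDirection g u v := by
  obtain ⟨h0, n, hn, k, hk⟩ := h
  refine ⟨fun hv => h0 (by rw [hv, smul_zero]), n, hn, k, fun w => ?_⟩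
  have := hk w
  simp only [secondForm, firstForm, map_smul, smul_apply, inner_smul_left, RCLike.conj_to_real] at this ⊢
  apply mul_left_cancel₀ hc
  linarith

/-- Around `0` the immersion `h` has a principal angle `ψ` that is single-valued on a disc.
Transported by the inversion it becomes `2t + π - ψ`, which gains `4π` along the circle; this equals
`wπ`. -/
lemma winding_eq_four {g h : E2 → E3} (hg : IsImmersion g) (hh : IsImmersion h)
    (hgh : ∀ y ≠ 0, g (invert y) = h y) (h0 : hopfCoeff h 0 ≠ 0) :
    ∃ r : ℝ, 0 < r ∧ ∀ w : ℤ, HasWinding (fun t => hopfCoeff g (r • dir t)) w → w = 4 := by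
  obtain ⟨ε, hε, hball⟩ := Metric.eventually_nhds_iff_ball.1
    (hh.contDiff_hopfCoeff.continuous.continuousAt.eventually_ne h0)
  obtain ⟨ψ, hψ, hψp⟩ := hh.exists_local_principalAngle Metric.isOpen_ball (convex_ball 0 ε)
    ⟨0, Metric.mem_ball_self hε⟩ hball
  have hδ : 0 < ε / 2 := by positivity
  set δ := ε / 2 with hδd
  have hmem : ∀ t, δ • dir t ∈ Metric.ball (0 : E2) ε := by
    intro t
    rw [mem_ball_zero_iff, norm_smul, norm_dir, Real.norm_of_nonneg hδ.le]
    linarith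
  refine ⟨4 / δ, by positivity, fun w hw => ?_⟩
  have hinc := hg.principalAngle_increment (continuous_circle (4 / δ)).continuousOn
    (circle_periodic (4 / δ)) hw (θ := fun t => 2 * t + Real.pi - ψ (δ • dir t))
    (((continuous_const.mul continuous_id).add continuous_const).continuousOn.sub
      (hψ.comp (continuous_circle δ).continuousOn fun t _ => hmem t)) (fun t _ => ?_)
  · rw [circle_periodic] at hinc
    have h1 : (w : ℝ) * Real.pi = 4 * Real.pi := by linarith
    exact_mod_cast mul_right_cancel₀ Real.pi_ne_zero h1
  · have hne : δ • dir t ≠ 0 := smul_ne_zero hδ.ne' (dir_ne_zero t)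
    have hev : h =ᶠ[𝓝 (δ • dir t)] g ∘ invert := by
      filter_upwards [isOpen_ne.mem_nhds hne] with y hy
      exact (hgh y hy).symm
    have := isPrincipalDirection_pullback hev hg.smooth (contDiffAt_invert hne) (hh.inj _)
      (hψp _ (hmem t))
    rw [invert_circle hδ, fderiv_invert_circle hδ] at this
    exact isPrincipalDirection_of_smul (by positivity) this

lemma exists_second_umbilic (hf : ∀ x, IsImmersion (localParam f x)) {p : S2}
    (hp : IsCMCUmbilic f p) : ∃ q, p ≠ q ∧ IsUmbilic f q := by
  by_contra! hno
  have hiso : IsIsolatedUmbilic f p :=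
    ⟨hp.1, eventually_nhdsWithin_of_forall fun x hx => hno x (Ne.symm hx)⟩
  obtain ⟨R, hR, w, hw0, hw⟩ := exists_winding_nonpos hf hp hiso
  obtain ⟨h, hh, hgh, hum⟩ := exists_inverted_param hf p
  have h0 : hopfCoeff h 0 ≠ 0 := fun h0 =>
    hno (-p) (ne_neg_of_mem_unit_sphere ℝ p) (hum ((hh.isUmbilicParam_iff 0).2 h0))
  obtain ⟨r, hr, h4⟩ := winding_eq_four (hf p) hh hgh h0
  -- Any radius enclosing both the small circle around `p` and the large one around `-p` would do.
  have hne : ∀ u, u ≠ 0 → ‖u‖ < R + r + 1 → hopfCoeff (localParam f p) u ≠ 0 := by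
    intro u hu _ h
    rw [← (hf p).isUmbilicParam_iff, ← isUmbilic_iff hf] at h
    exact hno _ (extChartAt_symm_ne p hu).symm h
  have hcirc : ∀ s, 0 < s → s ≤ R + r → ∀ t, ‖ellipse s 0 s t‖ < R + r + 1 := by
    intro s hs hsR t
    rw [← circle_eq_ellipse, norm_smul, norm_dir, Real.norm_of_nonneg hs.le, mul_one]
    linarith
  obtain ⟨w', h1, h2⟩ := exists_common_winding (hf p).contDiff_hopfCoeff.continuous hne
    (half_pos hR) (half_pos hR) hr hr (hcirc (R / 2) (half_pos hR) (by linarith))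
    (hcirc r hr (by linarith))
  simp only [← circle_eq_ellipse] at h1 h2
  have e1 := (hw (R / 2) ⟨half_pos hR, by linarith⟩).unique h1
  have e2 := h4 w' h2
  omega

end

end HopfSpheroid

end

theorem lemma5 (f : HopfSpheroid.S2 → HopfSpheroid.E3) (hf : HopfSpheroid.IsHopfSpheroid f) :
    (∃ p q : HopfSpheroid.S2, p ≠ q ∧
      HopfSpheroid.IsUmbilic f p ∧ HopfSpheroid.IsUmbilic f q) ∧
    (∀ p : HopfSpheroid.S2, HopfSpheroid.IsCMCUmbilic f p →
      HopfSpheroid.IsIsolatedUmbilic f p →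
        ∃ j : ℝ, (∀ i : ℝ, HopfSpheroid.HasUmbilicIndex f p i ↔ i = j) ∧ j ≤ 1) := by
  obtain ⟨⟨hs, hi, -⟩, p, hp⟩ := hf
  have himm : ∀ x, HopfSpheroid.IsImmersion (HopfSpheroid.localParam f x) :=
    HopfSpheroid.IsImmersion.localParam hs hi
  constructor
  · obtain ⟨q, hpq, hq⟩ := HopfSpheroid.exists_second_umbilic himm hp
    exact ⟨p, q, hpq, hp.1, hq⟩
  · intro p hp hiso
    obtain ⟨R, hR, w, hw0, hw⟩ := HopfSpheroid.exists_winding_nonpos himm hp hiso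
    -- The bound obtained is `w / 2 ≤ 0`, stronger than required.
    refine ⟨w / 2, HopfSpheroid.hasUmbilicIndex_iff himm hR hw, ?_⟩
    have : (w : ℝ) ≤ 0 := by exact_mod_cast hw0
    linarith
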